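/- Let $\mathbb K=\mathbb R$ or $\mathbb C$ and let $\mathfrak g=\mathfrak g_0\oplus\mathfrak g_1$ be a Lie superalgebra over $\mathbb K$ with a finite homogeneous basis $X_1,\dots,X_n\in\mathfrak g_0$, $\theta_1,\dots,\theta_m\in\mathfrak g_1$ such that $$[X_\mu,X_\nu]=\sum_{\alpha=1}^n C_{\mu\nu\alpha}X_\alpha,\qquad [\theta_a,X_\nu]=\sum_{b=1}^m K_{a\nu b}\,\theta_b,\qquad [\theta_a,\theta_b]=0 .$$ Let $\mathcal A_{(n,m)}$ be the Weyl superalgebra: the associative unital $\mathbb K$-algebra generated by even elements $x_\mu,\partial_\mu$ ($1\le\mu\le n$) and odd elements $\xi_a,q_a$ ($1\le a\le m$) subject to $[\partial_\mu,x_\nu]=\delta_{\mu\nu}$ and $[q_a,\xi_b]=\delta_{ab}$, all other supercommutators of generators being zero, where $[u,v]=uv-(-1)^{\bar u\bar v}vu$ for homogeneous $u,v$. Let $\hat{\mathcal A}_{(n,m)}$ be its semicompletion, i.e. its completion with respect to the degree in the $\partial_\mu$ and $q_a$, whose elements are formal power series in the $\partial_\mu,q_a$ with coefficients polynomial in the $x_\mu,\xi_a$;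 it inherits the $\mathbb Z_2$-grading and the supercommutator. Let $\mathcal C$ be the $n\times n$ matrix $\mathcal C_{\mu\nu}=\sum_{\alpha=1}^n C_{\mu\alpha\nu}\,\partial_\alpha$ and $$\psi(t)=\frac{t}{1-e^{-t}}=\sum_{k=0}^\infty B_k\frac{(-1)^k}{k!}\,t^k,$$ where $B_k$ are the Bernoulli numbers (with $B_1=-\tfrac12$). Then every entry of the series $\psi(\mathcal C)=\sum_{k\ge 0} B_k\frac{(-1)^k}{k!}\,\mathcal C^k$ converges in $\hat{\mathcal A}_{(n,m)}$, and the linear map $\varphi\colon\mathfrak g\to\hat{\mathcal A}_{(n,m)}$ defined on the basis by $$\varphi(X_\mu)=\sum_{\alpha=1}^n x_\alpha\,\psi(\mathcal C)_{\mu\alpha}-\sum_{a,b=1}^m K_{b\mu a}\,\xi_a q_b,\qquad \varphi(\theta_a)=\xi_a,$$ is a realization of $\mathfrak g$: it preserves the $\mathbb Z_2$-degree, and $\varphi([Y,Z])=[\varphi(Y),\varphi(Z)]$ for all homogeneous $Y,Z\in\mathfrak g$, the bracket on the right being the supercommutator of $\hat{\mathcal A}_{(n,m)}$. -/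

import Mathlib

open scoped BigOperators

noncomputable section

/-! ### Lie superalgebras -/

/-- A Lie superalgebra over a field `𝕜` (of characteristic zero) on the vector space `g`: a
`ℤ/2`-grading `g = g₀ ⊕ g₁` and an even bilinear bracket that is graded skew-symmetric and
satisfies the graded Jacobi identity. -/
structure LieSuperalgebra (𝕜 : Type*) (g : Type*) [Field 𝕜] [AddCommGroup g] [Module 𝕜 g] where
  part : ZMod 2 → Submodule 𝕜 g
  isInternal : DirectSum.IsInternal part
  bracket : g →ₗ[𝕜] g →ₗ[𝕜] g
  bracket_mem : ∀ (i j : ZMod 2) (x y : g), x ∈ part i → y ∈ part j → bracket x y ∈ part (i + j)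
  skew : ∀ (i j : ZMod 2) (x y : g), x ∈ part i → y ∈ part j →
    bracket x y = -((-1 : 𝕜) ^ (i.val * j.val) • bracket y x)
  jacobi : ∀ (i j k : ZMod 2) (x y z : g), x ∈ part i → y ∈ part j → z ∈ part k →
    (-1 : 𝕜) ^ (i.val * k.val) • bracket x (bracket y z)
      + (-1 : 𝕜) ^ (j.val * i.val) • bracket y (bracket z x)
      + (-1 : 𝕜) ^ (k.val * j.val) • bracket z (bracket x y) = 0

/-! ### The Weyl superalgebra -/

/-- The generators `x_μ`, `∂_μ`, `ξ_a`, `q_a` of the Weyl superalgebra. -/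
inductive WeylGen (n m : ℕ) : Type
  | x : Fin n → WeylGen n m
  | d : Fin n → WeylGen n m
  | xi : Fin m → WeylGen n m
  | q : Fin m → WeylGen n m

namespace WeylGen

variable {n m : ℕ}

/-- The degrees of the generators: `x_μ`, `∂_μ` are even, `ξ_a`, `q_a` are odd. -/
def parity : WeylGen n m → ZMod 2
  | x _ => 0
  | d _ => 0
  | xi _ => 1
  | q _ => 1

/-- The scalar `ω(s, t)` with `[s, t] = ω(s, t) · 1` in the Weyl superalgebra: `[∂_μ, x_ν] = δ_μν`,
`[q_a, ξ_b] = δ_ab`, together with the values forced by graded skew-symmetry; all the other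
supercommutators of generators vanish. -/
def pairing (𝕜 : Type*) [Field 𝕜] : WeylGen n m → WeylGen n m → 𝕜
  | d μ, x ν => if μ = ν then 1 else 0
  | x ν, d μ => if μ = ν then -1 else 0
  | q a, xi b => if a = b then 1 else 0
  | xi b, q a => if a = b then 1 else 0
  | _, _ => 0

/-- The generators `∂_μ` and `q_a`, in which formal power series are allowed. -/
def IsLowering : WeylGen n m → Prop
  | x _ => False
  | d _ => True
  | xi _ => False
  | q _ => True

end WeylGen

/-- The defining relations `s t - (-1)^(deg s deg t) t s = ω(s, t)` for all generators `s`, `t`. -/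
inductive WeylRel (𝕜 : Type*) [Field 𝕜] (n m : ℕ) :
    FreeAlgebra 𝕜 (WeylGen n m) → FreeAlgebra 𝕜 (WeylGen n m) → Prop
  | supercomm (s t : WeylGen n m) : WeylRel 𝕜 n m
      (FreeAlgebra.ι 𝕜 s * FreeAlgebra.ι 𝕜 t
        - (-1 : 𝕜) ^ (s.parity.val * t.parity.val) • (FreeAlgebra.ι 𝕜 t * FreeAlgebra.ι 𝕜 s))
      (algebraMap 𝕜 _ (WeylGen.pairing 𝕜 s t))

/-- The Weyl superalgebra `A_(n,m)`. -/
def WeylSuper (𝕜 : Type*) [Field 𝕜] (n m : ℕ) : Type _ := RingQuot (WeylRel 𝕜 n m)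

namespace WeylSuper

variable (𝕜 : Type*) [Field 𝕜] (n m : ℕ)

instance : Ring (WeylSuper 𝕜 n m) := inferInstanceAs (Ring (RingQuot (WeylRel 𝕜 n m)))

instance : Algebra 𝕜 (WeylSuper 𝕜 n m) :=
  inferInstanceAs (Algebra 𝕜 (RingQuot (WeylRel 𝕜 n m)))

variable {n m}

/-- The quotient map from the free algebra onto the Weyl superalgebra. -/
def mk : FreeAlgebra 𝕜 (WeylGen n m) →ₐ[𝕜] WeylSuper 𝕜 n m :=
  RingQuot.mkAlgHom 𝕜 (WeylRel 𝕜 n m)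

theorem mk_surjective : Function.Surjective (mk 𝕜 (n := n) (m := m)) :=
  RingQuot.mkAlgHom_surjective 𝕜 (WeylRel 𝕜 n m)

/-- A generator as an element of the Weyl superalgebra. -/
def gen (s : WeylGen n m) : WeylSuper 𝕜 n m := mk 𝕜 (FreeAlgebra.ι 𝕜 s)

theorem gen_rel (s t : WeylGen n m) :
    gen 𝕜 s * gen 𝕜 t
        - (-1 : 𝕜) ^ (s.parity.val * t.parity.val) • (gen 𝕜 t * gen 𝕜 s)
      = algebraMap 𝕜 (WeylSuper 𝕜 n m) (WeylGen.pairing 𝕜 s t) := by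
  have h : mk 𝕜 _ = mk 𝕜 _ := RingQuot.mkAlgHom_rel 𝕜 (WeylRel.supercomm (𝕜 := 𝕜) s t)
  rw [map_sub, map_smul, map_mul, map_mul, AlgHom.commutes] at h
  exact h

variable (n m)

/-- The even (`i = 0`) and the odd (`i = 1`) part of the Weyl superalgebra, spanned by the words
in the generators whose degrees sum up to `i`. -/
def part (i : ZMod 2) : Submodule 𝕜 (WeylSuper 𝕜 n m) :=
  Submodule.span 𝕜 {w | ∃ l : List (WeylGen n m),
    (l.map WeylGen.parity).sum = i ∧ w = (l.map (gen 𝕜)).prod}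

/-- The span of the generators `∂_μ` and `q_a`. -/
def lowering : Submodule 𝕜 (WeylSuper 𝕜 n m) :=
  Submodule.span 𝕜 {w | ∃ s : WeylGen n m, s.IsLowering ∧ w = gen 𝕜 s}

/-- The left ideal spanned by the products `u D₁ ⋯ D_k`, where `u` is any element and each `D_i` is
one of the `∂_μ`, `q_a`. -/
def filtration (k : ℕ) : Submodule 𝕜 (WeylSuper 𝕜 n m) := ⊤ * lowering 𝕜 n m ^ k

theorem filtration_succ (k : ℕ) :
    filtration 𝕜 n m (k + 1) = filtration 𝕜 n m k * lowering 𝕜 n m := by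
  rw [filtration, filtration, pow_succ, mul_assoc]

theorem filtration_zero : filtration 𝕜 n m 0 = ⊤ := by
  rw [filtration, pow_zero, mul_one]

theorem top_mul_top : (⊤ : Submodule 𝕜 (WeylSuper 𝕜 n m)) * ⊤ = ⊤ :=
  top_le_iff.1 fun x _ => by
    simpa using Submodule.mul_mem_mul (Submodule.mem_top (R := 𝕜) (x := x))
      (Submodule.mem_top (R := 𝕜) (x := (1 : WeylSuper 𝕜 n m)))

theorem mul_mem_filtration (k : ℕ) (a b : WeylSuper 𝕜 n m) (hb : b ∈ filtration 𝕜 n m k) :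
    a * b ∈ filtration 𝕜 n m k := by
  have h := Submodule.mul_mem_mul (Submodule.mem_top (R := 𝕜) (x := a)) hb
  rwa [filtration, ← mul_assoc, top_mul_top] at h

theorem filtration_succ_le (k : ℕ) : filtration 𝕜 n m (k + 1) ≤ filtration 𝕜 n m k := by
  rw [filtration, filtration, pow_succ', ← mul_assoc]
  exact mul_le_mul' le_top le_rfl

theorem filtration_antitone : Antitone (filtration 𝕜 n m) :=
  antitone_nat_of_succ_le (filtration_succ_le 𝕜 n m)

theorem mul_gen_mem_filtration (s : WeylGen n m) (k : ℕ) (b : WeylSuper 𝕜 n m)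
    (hb : b ∈ filtration 𝕜 n m (k + 1)) : b * gen 𝕜 s ∈ filtration 𝕜 n m k := by
  induction k generalizing b with
  | zero => rw [filtration_zero]; trivial
  | succ k ih =>
    rw [filtration_succ] at hb
    induction hb using Submodule.mul_induction_on' with
    | mem_mul_mem u hu v hv =>
      induction hv using Submodule.span_induction with
      | mem v hv =>
        obtain ⟨t, ht, rfl⟩ := hv
        have h := gen_rel 𝕜 t s
        rw [sub_eq_iff_eq_add] at h
        rw [mul_assoc, h, mul_add, mul_smul_comm, ← mul_assoc]
        refine add_mem ?_ (Submodule.smul_mem _ _ ?_)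
        · rw [← Algebra.commutes, ← Algebra.smul_def]
          exact Submodule.smul_mem _ _ hu
        · rw [filtration_succ]
          exact Submodule.mul_mem_mul (ih u hu) (Submodule.subset_span ⟨t, ht, rfl⟩)
      | zero => simp
      | add v w _ _ h₁ h₂ => rw [mul_add, add_mul]; exact add_mem h₁ h₂
      | smul c v _ h₁ =>
        rw [mul_smul_comm, smul_mul_assoc]; exact Submodule.smul_mem _ _ h₁
    | add u _ v _ h₁ h₂ => rw [add_mul]; exact add_mem h₁ h₂

theorem exists_mul_mem_filtration (a : WeylSuper 𝕜 n m) (k : ℕ) :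
    ∃ j, ∀ b ∈ filtration 𝕜 n m j, b * a ∈ filtration 𝕜 n m k := by
  obtain ⟨p, rfl⟩ := mk_surjective 𝕜 a
  induction p using FreeAlgebra.induction generalizing k with
  | grade0 r =>
    refine ⟨k, fun b hb => ?_⟩
    rw [AlgHom.commutes, ← Algebra.commutes, ← Algebra.smul_def]
    exact Submodule.smul_mem _ _ hb
  | grade1 s => exact ⟨k + 1, fun b hb => mul_gen_mem_filtration 𝕜 n m s k b hb⟩
  | mul p r hp hr =>
    obtain ⟨j, hj⟩ := hr k
    obtain ⟨i, hi⟩ := hp j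
    refine ⟨i, fun b hb => ?_⟩
    rw [map_mul]
    have h := hj _ (hi b hb)
    rw [mul_assoc] at h
    exact h
  | add p r hp hr =>
    obtain ⟨i, hi⟩ := hp k
    obtain ⟨j, hj⟩ := hr k
    refine ⟨max i j, fun b hb => ?_⟩
    rw [map_add]
    have h := add_mem (hi b (filtration_antitone 𝕜 n m (le_max_left i j) hb))
      (hj b (filtration_antitone 𝕜 n m (le_max_right i j) hb))
    rw [← mul_add] at h
    exact h

theorem ringSubgroupsBasis :
    RingSubgroupsBasis (fun k => (filtration 𝕜 n m k).toAddSubgroup) where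
  inter i j := ⟨max i j, le_inf
    (fun _ h => filtration_antitone 𝕜 n m (le_max_left i j) h)
    (fun _ h => filtration_antitone 𝕜 n m (le_max_right i j) h)⟩
  mul i := ⟨i, by
    rintro _ ⟨a, _, b, hb, rfl⟩
    exact mul_mem_filtration 𝕜 n m i a b hb⟩
  leftMul a i := ⟨i, fun b hb => mul_mem_filtration 𝕜 n m i a b hb⟩
  rightMul a i := exists_mul_mem_filtration 𝕜 n m a i

/-- The topology on the Weyl superalgebra in which the left ideals `filtration k` form a basis of
neighbourhoods of zero. -/
instance : TopologicalSpace (WeylSuper 𝕜 n m) := (ringSubgroupsBasis 𝕜 n m).topology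

instance : IsTopologicalRing (WeylSuper 𝕜 n m) :=
  (ringSubgroupsBasis 𝕜 n m).toRingFilterBasis.isTopologicalRing

instance : UniformSpace (WeylSuper 𝕜 n m) := IsTopologicalAddGroup.rightUniformSpace _

instance : IsUniformAddGroup (WeylSuper 𝕜 n m) := isUniformAddGroup_of_addCommGroup

instance : UniformContinuousConstSMul 𝕜 (WeylSuper 𝕜 n m) where
  uniformContinuous_const_smul c := by
    have h := uniformContinuous_addMonoidHom_of_continuous
      (f := AddMonoidHom.mulLeft (algebraMap 𝕜 (WeylSuper 𝕜 n m) c))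
      (continuous_const_mul (algebraMap 𝕜 (WeylSuper 𝕜 n m) c))
    exact h.congr fun a => (Algebra.smul_def c a).symm

end WeylSuper

/-! ### The semicompleted Weyl superalgebra -/

/-- The semicompletion of the Weyl superalgebra `A_(n,m)`: its completion with respect to the
degree in `∂_μ`, `q_a`. Its elements are the formal power series in `∂_μ`, `q_a` with coefficients
polynomial in `x_μ`, `ξ_a` (written on the left). -/
abbrev WeylSuperHat (𝕜 : Type*) [Field 𝕜] (n m : ℕ) : Type _ :=
  UniformSpace.Completion (WeylSuper 𝕜 n m)

namespace WeylSuperHat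

variable (𝕜 : Type*) [Field 𝕜] {n m : ℕ}

/-- A generator as an element of the semicompleted Weyl superalgebra. -/
def gen (s : WeylGen n m) : WeylSuperHat 𝕜 n m := (WeylSuper.gen 𝕜 s : WeylSuperHat 𝕜 n m)

variable (n m)

/-- The even (`i = 0`) and the odd (`i = 1`) part of the semicompleted Weyl superalgebra: the limits
of even, respectively odd, elements of the Weyl superalgebra. -/
def part (i : ZMod 2) : Submodule 𝕜 (WeylSuperHat 𝕜 n m) :=
  (Submodule.span 𝕜
    ((fun a : WeylSuper 𝕜 n m => (a : WeylSuperHat 𝕜 n m)) '' (WeylSuper.part 𝕜 n m i))).topologicalClosure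

end WeylSuperHat

/-- The supercommutator `[u, v] = u v - (-1)^(i j) v u` of elements `u`, `v` of degrees `i`, `j`. -/
def superComm (𝕜 : Type*) [Field 𝕜] {A : Type*} [Ring A] [Algebra 𝕜 A] (i j : ZMod 2) (u v : A) :
    A :=
  u * v - (-1 : 𝕜) ^ (i.val * j.val) • (v * u)

/-- A linear map `φ` from a Lie superalgebra to the semicompleted Weyl superalgebra is a
realization if it is a homomorphism of Lie superalgebras, for the supercommutator: it preserves the
degrees and the brackets of homogeneous elements. -/
def LieSuperalgebra.IsRealization {𝕜 : Type*} {g : Type*} [Field 𝕜] [AddCommGroup g] [Module 𝕜 g]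
    (L : LieSuperalgebra 𝕜 g) {n m : ℕ} (φ : g →ₗ[𝕜] WeylSuperHat 𝕜 n m) : Prop :=
  (∀ (i : ZMod 2) (x : g), x ∈ L.part i → φ x ∈ WeylSuperHat.part 𝕜 n m i) ∧
  ∀ (i j : ZMod 2) (x y : g), x ∈ L.part i → y ∈ L.part j →
    φ (L.bracket x y) = superComm 𝕜 i j (φ x) (φ y)

/-! ### The Weyl-linear map -/

section WeylLinear

variable {𝕜 : Type*} [Field 𝕜] {n : ℕ} (m : ℕ)

/-- The coefficient `(-1)^k B_k / k!` of `t^k` in `ψ(t) = t / (1 - e^(-t))`, where `B_k` are the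
Bernoulli numbers, with `B_1 = -1/2`. -/
def psiCoeff (𝕜 : Type*) [Field 𝕜] (k : ℕ) : 𝕜 := (bernoulli k : 𝕜) * ((-1) ^ k / k.factorial)

/-- The matrix `𝒞_μν = ∑_α C_μαν ∂_α` over the semicompleted Weyl superalgebra. -/
def matC (C : Fin n → Fin n → Fin n → 𝕜) : Matrix (Fin n) (Fin n) (WeylSuperHat 𝕜 n m) :=
  Matrix.of fun μ ν => ∑ α, C μ α ν • WeylSuperHat.gen 𝕜 (WeylGen.d α)

/-- The matrix `ψ(𝒞) = ∑_k (-1)^k B_k / k! 𝒞^k`, entry by entry. -/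
def psiC (C : Fin n → Fin n → Fin n → 𝕜) : Matrix (Fin n) (Fin n) (WeylSuperHat 𝕜 n m) :=
  Matrix.of fun μ α => ∑' k : ℕ, psiCoeff 𝕜 k • (matC m C ^ k) μ α

variable {m}

/-- The linear map `φ` given on the basis `X_1, …, X_n, θ_1, …, θ_m` by
`φ(X_μ) = ∑_α x_α ψ(𝒞)_μα - ∑_{a,b} K_bμa ξ_a q_b` and `φ(θ_a) = ξ_a`. -/
def weylLinear {g : Type*} [AddCommGroup g] [Module 𝕜 g] (Z : Module.Basis (Fin n ⊕ Fin m) 𝕜 g)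
    (C : Fin n → Fin n → Fin n → 𝕜) (K : Fin m → Fin n → Fin m → 𝕜) :
    g →ₗ[𝕜] WeylSuperHat 𝕜 n m :=
  Z.constr 𝕜 (Sum.elim
    (fun μ =>
      ∑ α, WeylSuperHat.gen 𝕜 (WeylGen.x α) * psiC m C μ α
        - ∑ a, ∑ b, K b μ a •
            (WeylSuperHat.gen 𝕜 (WeylGen.xi a) * WeylSuperHat.gen 𝕜 (WeylGen.q b)))
    (fun a => WeylSuperHat.gen 𝕜 (WeylGen.xi a)))

end WeylLinear

end

/-!
The elements `∑_α x_α u_α(∂)` commute like vector fields in commuting variables `p_α`, so the even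
part of the claim says that the vector fields `V_μ = ∑_α ψ(𝒞)_μα ∂/∂p_α` satisfy
`[V_μ, V_ν] = -∑_α C_μνα V_α` (`psiTerm_bracket`). To prove it, replace `𝒞` by `X 𝒞` with a formal
variable `X`, so that `[V_μ, V_ν] + X ∑_α C_μνα V_α` (`curvature`) becomes a family of power series
in `X`. The function `ψ(t) = t / (1 - exp (-t))` satisfies the Riccati equation
`t ψ' = ψ + t ψ - ψ²` (`euler_bernoulli'PowerSeries`), hence so does `ψ(X 𝒞)` for the Euler
derivation `X d/dX`. With skew-symmetry and the Jacobi identity this gives a linear homogeneous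
equation for the curvature (`derivation_curvature`), which forces its coefficients to vanish one
after the other (`curvature_eq_zero`). No inverse of `ψ` and no integration is needed.

The elements `∑_{a,b} A_ab ξ_a q_b` commute like the matrices `A` (`fermi_commutator`), act on the
`ξ_a` through `A`, and commute with the `x_μ` and `∂_μ`; so the odd generators contribute the
Jacobi identity for one odd and two even elements (`structureConstants_commutator`).

Infinite series enter only through limits. If `ψ(𝒞)` is truncated in degrees above `N`, the images
of the `X_μ` lie in the Weyl superalgebra itself, where their commutators are right up to an element
of filtration degree `N` (`truncImage_commutator_mem_filtration`). Multiplication of the completion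
is continuous, so letting `N` grow gives the claim.
-/

noncomputable section

open Finset

/-! ### Coefficientwise derivations of power series -/

namespace PowerSeries

/-- The extension of a derivation `d` of `R` to `R⟦X⟧` that acts on the coefficients, so that it
kills the variable. -/
def mapCoeffs {k R : Type*} [CommRing k] [CommRing R] [Algebra k R] (d : Derivation k R R) :
    Derivation k R⟦X⟧ R⟦X⟧ :=
  Derivation.mk'
    { toFun := fun f => mk fun i => d (coeff i f)
      map_add' := fun f h => by ext i; simp
      map_smul' := fun c f => by
        ext i
        have h : ∀ f : R⟦X⟧, coeff i (c • f) = c • coeff i f := fun _ => rfl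
        rw [RingHom.id_apply, coeff_mk, h, h, coeff_mk, d.map_smul] }
    fun f h => by
      ext i
      simp only [LinearMap.coe_mk, AddHom.coe_mk, coeff_mk, smul_eq_mul, map_add, coeff_mul,
        map_sum, Derivation.leibniz, sum_add_distrib]
      congr 1
      rw [← Finset.Nat.sum_antidiagonal_swap]
      rfl

@[simp]
theorem coeff_mapCoeffs {k R : Type*} [CommRing k] [CommRing R] [Algebra k R]
    (d : Derivation k R R) (f : R⟦X⟧) (i : ℕ) : coeff i (mapCoeffs d f) = d (coeff i f) :=
  coeff_mk i fun j => d (coeff j f)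

/-- The Euler derivation `X d/dX`, which multiplies the coefficient of `X ^ i` by `i`. -/
def euler (R : Type*) [CommRing R] : Derivation R R⟦X⟧ R⟦X⟧ := (X : R⟦X⟧) • derivative R

@[simp]
theorem coeff_euler {R : Type*} [CommRing R] (f : R⟦X⟧) (i : ℕ) :
    coeff i (euler R f) = i * coeff i f := by
  rw [euler, Derivation.smul_apply, smul_eq_mul]
  cases i with
  | zero => simp
  | succ i => rw [coeff_succ_X_mul, coeff_derivative]; push_cast; ring

theorem euler_mapCoeffs {k R : Type*} [CommRing k] [CommRing R] [Algebra k R]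
    (d : Derivation k R R) (f : R⟦X⟧) : euler R (mapCoeffs d f) = mapCoeffs d (euler R f) := by
  ext i
  simp

end PowerSeries

/-! ### The Riccati equation of the Bernoulli generating function -/

section Bernoulli

open PowerSeries

theorem psiCoeff_eq_coeff (𝕜 : Type*) [Field 𝕜] [CharZero 𝕜] (k : ℕ) :
    psiCoeff 𝕜 k = coeff k (bernoulli'PowerSeries 𝕜) := by
  rw [psiCoeff, bernoulli'PowerSeries, coeff_mk, bernoulli]
  have h : ((-1 : 𝕜) ^ k) * (-1) ^ k = 1 := by rw [← mul_pow]; simp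
  simp only [map_div₀, map_natCast, eq_ratCast]
  push_cast
  linear_combination (bernoulli' k / k.factorial : 𝕜) * h

/-- The Riccati equation `X ψ' = ψ + X ψ - ψ²` of `ψ = X / (1 - exp (-X))`. -/
theorem euler_bernoulli'PowerSeries (𝕜 : Type*) [Field 𝕜] [CharZero 𝕜] :
    euler 𝕜 (bernoulli'PowerSeries 𝕜) = bernoulli'PowerSeries 𝕜 + X * bernoulli'PowerSeries 𝕜
      - bernoulli'PowerSeries 𝕜 * bernoulli'PowerSeries 𝕜 := by
  have h := bernoulli'PowerSeries_mul_exp_sub_one 𝕜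
  have hexp : derivative 𝕜 (exp 𝕜) = exp 𝕜 := derivative_exp 𝕜
  have h0 : exp 𝕜 - 1 ≠ 0 := fun h0 => by simpa using congrArg (coeff 1) h0
  have hd := congrArg (derivative 𝕜) h
  simp only [Derivation.leibniz, map_sub, hexp, derivative_X, smul_eq_mul, derivative_one] at hd
  refine mul_right_cancel₀ h0 ?_
  rw [euler, Derivation.smul_apply, smul_eq_mul]
  linear_combination X * hd - (1 + X - bernoulli'PowerSeries 𝕜) * h

/-- The recursion for the coefficients of `ψ`, of which Euler's quadratic identity for the
Bernoulli numbers is a form. -/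
theorem psiCoeff_recursion (𝕜 : Type*) [Field 𝕜] [CharZero 𝕜] (k : ℕ) :
    ((k + 1 : ℕ) : 𝕜) * psiCoeff 𝕜 (k + 1) = psiCoeff 𝕜 (k + 1) + psiCoeff 𝕜 k
      - ∑ p ∈ antidiagonal (k + 1), psiCoeff 𝕜 p.1 * psiCoeff 𝕜 p.2 := by
  have h := congrArg (coeff (k + 1)) (euler_bernoulli'PowerSeries 𝕜)
  rw [coeff_euler, map_sub, map_add, coeff_succ_X_mul, coeff_mul] at h
  simpa only [psiCoeff_eq_coeff] using h

theorem psiCoeff_zero (𝕜 : Type*) [Field 𝕜] : psiCoeff 𝕜 0 = 1 := by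
  simp [psiCoeff]

end Bernoulli

/-! ### Vanishing of the curvature -/

section Curvature

variable {ι S : Type*} [Fintype ι] [CommRing S]

/-- For the vector fields `V_μ = ∑_β ψ_μβ D_β`, the coefficient of `D_γ` in
`[V_μ, V_ν] + ∑_α c_μνα V_α`, if the `D_β` commute. It measures the failure of the `V_μ` to be a
representation of the Lie algebra with structure constants `-c`. -/
def curvature {k : Type*} [CommRing k] [Algebra k S] (D : ι → Derivation k S S)
    (c : ι → ι → ι → S) (ψ : ι → ι → S) (μ ν γ : ι) : S :=
  ∑ β, ψ μ β * D β (ψ ν γ) - ∑ β, ψ ν β * D β (ψ μ γ) + ∑ α, c μ ν α * ψ α γ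

/-- The effect of the Euler derivation on one half of the curvature. Only the last sum is not of
the shape that occurs in `derivation_curvature`; it combines with the terms in `c`. -/
theorem derivation_sum_mul_derivation {k k' : Type*} [CommRing k] [Algebra k S] [CommRing k']
    [Algebra k' S] (θ : Derivation k' S S) (D : ι → Derivation k S S)
    (hcomm : ∀ β f, θ (D β f) = D β (θ f)) (c : ι → ι → ι → S) (ψ A : ι → ι → S)
    (hψ : ∀ μ ν, θ (ψ μ ν) = ψ μ ν + ∑ ρ, (A μ ρ - ψ μ ρ) * ψ ρ ν)
    (hA : ∀ β μ ν, D β (A μ ν) = c μ β ν) (μ ν γ : ι) :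
    θ (∑ β, ψ μ β * D β (ψ ν γ)) = 2 * ∑ β, ψ μ β * D β (ψ ν γ)
      + ∑ ρ, (A μ ρ - ψ μ ρ) * ∑ β, ψ ρ β * D β (ψ ν γ)
      + ∑ ρ, (A ν ρ - ψ ν ρ) * ∑ β, ψ μ β * D β (ψ ρ γ)
      - ∑ ρ, (∑ β, ψ μ β * D β (ψ ν ρ)) * ψ ρ γ
      + ∑ ρ, (∑ β, ψ μ β * c ν β ρ) * ψ ρ γ := by
  simp only [mul_sum, sum_mul]
  rw [sum_comm (f := fun ρ β => (A μ ρ - ψ μ ρ) * _),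
    sum_comm (f := fun ρ β => (A ν ρ - ψ ν ρ) * _),
    sum_comm (f := fun ρ β => ψ μ β * D β (ψ ν ρ) * _),
    sum_comm (f := fun ρ β => ψ μ β * c ν β ρ * _), map_sum, ← sum_add_distrib,
    ← sum_add_distrib, ← sum_sub_distrib, ← sum_add_distrib]
  refine sum_congr rfl fun β _ => ?_
  rw [Derivation.leibniz, hcomm, hψ, hψ, map_add, map_sum, smul_eq_mul, smul_eq_mul, mul_add,
    mul_add, mul_sum, mul_sum]
  have h : ∀ ρ, ψ μ β * D β ((A ν ρ - ψ ν ρ) * ψ ρ γ) = (A ν ρ - ψ ν ρ) * (ψ μ β * D β (ψ ρ γ))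
      - ψ μ β * D β (ψ ν ρ) * ψ ρ γ + ψ μ β * c ν β ρ * ψ ρ γ := fun ρ => by
    rw [Derivation.leibniz, map_sub, hA, smul_eq_mul, smul_eq_mul]
    ring
  have h' : ∀ ρ, D β (ψ ν γ) * ((A μ ρ - ψ μ ρ) * ψ ρ β)
      = (A μ ρ - ψ μ ρ) * (ψ ρ β * D β (ψ ν γ)) := fun ρ => by ring
  simp only [h, h', sum_add_distrib, sum_sub_distrib]
  ring

/-- Along the Euler derivation the curvature obeys a linear equation without inhomogeneous term;
this is where skew-symmetry and the Jacobi identity enter. -/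
theorem derivation_curvature {k k' : Type*} [CommRing k] [Algebra k S] [CommRing k']
    [Algebra k' S] (θ : Derivation k' S S) (D : ι → Derivation k S S)
    (hcomm : ∀ β f, θ (D β f) = D β (θ f)) (c : ι → ι → ι → S) (ψ A : ι → ι → S)
    (hψ : ∀ μ ν, θ (ψ μ ν) = ψ μ ν + ∑ ρ, (A μ ρ - ψ μ ρ) * ψ ρ ν)
    (hA : ∀ β μ ν, D β (A μ ν) = c μ β ν) (hc : ∀ μ ν α, θ (c μ ν α) = c μ ν α)
    (hskew : ∀ μ ν α, c μ ν α = -c ν μ α)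
    (hjac : ∀ μ ν α, ∑ ρ, (A μ ρ * c ρ ν α + A ν ρ * c μ ρ α - c μ ν ρ * A ρ α) = 0)
    (μ ν γ : ι) :
    θ (curvature D c ψ μ ν γ) = 2 * curvature D c ψ μ ν γ
      + ∑ ρ, ((A μ ρ - ψ μ ρ) * curvature D c ψ ρ ν γ + (A ν ρ - ψ ν ρ) * curvature D c ψ μ ρ γ
        - curvature D c ψ μ ν ρ * ψ ρ γ) := by
  have hcψ : θ (∑ α, c μ ν α * ψ α γ) = 2 * ∑ α, c μ ν α * ψ α γ
      + ∑ α, (∑ ρ, c μ ν ρ * (A ρ α - ψ ρ α)) * ψ α γ := by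
    simp only [sum_mul]
    rw [sum_comm, map_sum, mul_sum, ← sum_add_distrib]
    refine sum_congr rfl fun α _ => ?_
    rw [Derivation.leibniz, hψ, hc, smul_eq_mul, smul_eq_mul, mul_add, mul_sum,
      sum_congr rfl fun ρ _ => (mul_assoc (c μ ν α) (A α ρ - ψ α ρ) (ψ ρ γ)).symm]
    ring
  have key : ∑ ρ, (A μ ρ - ψ μ ρ) * ∑ α, c ρ ν α * ψ α γ
      + ∑ ρ, (A ν ρ - ψ ν ρ) * ∑ α, c μ ρ α * ψ α γ - ∑ ρ, (∑ α, c μ ν α * ψ α ρ) * ψ ρ γ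
      - ∑ ρ, (∑ β, ψ μ β * c ν β ρ) * ψ ρ γ + ∑ ρ, (∑ β, ψ ν β * c μ β ρ) * ψ ρ γ
      - ∑ α, (∑ ρ, c μ ν ρ * (A ρ α - ψ ρ α)) * ψ α γ = 0 := by
    have h1 : ∀ (M : ι → S) (e : ι → ι → S), ∑ ρ, M ρ * ∑ α, e ρ α * ψ α γ
        = ∑ α, (∑ ρ, M ρ * e ρ α) * ψ α γ := fun M e => by
      simp only [mul_sum, sum_mul, mul_assoc]
      exact sum_comm
    rw [h1, h1, ← sum_add_distrib, ← sum_sub_distrib, ← sum_sub_distrib, ← sum_add_distrib,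
      ← sum_sub_distrib]
    refine sum_eq_zero fun α _ => ?_
    rw [← add_mul, ← sub_mul, ← sub_mul, ← add_mul, ← sub_mul]
    refine mul_eq_zero_of_left ?_ _
    rw [← hjac μ ν α, ← sum_add_distrib, ← sum_sub_distrib, ← sum_sub_distrib, ← sum_add_distrib,
      ← sum_sub_distrib]
    refine sum_congr rfl fun ρ _ => ?_
    rw [hskew ν ρ α]
    ring
  simp only [curvature, map_add, map_sub, mul_add, mul_sub, add_mul, sub_mul, sum_add_distrib,
    sum_sub_distrib] at key ⊢
  rw [derivation_sum_mul_derivation θ D hcomm c ψ A hψ hA,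
    derivation_sum_mul_derivation θ D hcomm c ψ A hψ hA, hcψ]
  simp only [mul_sub, sub_mul, sum_sub_distrib] at key ⊢
  linear_combination -key

open PowerSeries in
/-- For power series with `ψ ≡ 1` and `A ≡ 0` modulo `X`, the coefficient of `X ^ i` in the
equation of `derivation_curvature` expresses `(i + 1)` times the coefficient of the curvature by
lower ones, so that the curvature vanishes. -/
theorem curvature_eq_zero {R : Type*} [CommRing R] [IsAddTorsionFree R] [DecidableEq ι]
    {k : Type*} [CommRing k] [Algebra k R] (D : ι → Derivation k R⟦X⟧ R⟦X⟧)
    (hcomm : ∀ β f, euler R (D β f) = D β (euler R f)) (c : ι → ι → ι → R⟦X⟧)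
    (ψ A : ι → ι → R⟦X⟧)
    (hψ : ∀ μ ν, euler R (ψ μ ν) = ψ μ ν + ∑ ρ, (A μ ρ - ψ μ ρ) * ψ ρ ν)
    (hA : ∀ β μ ν, D β (A μ ν) = c μ β ν) (hc : ∀ μ ν α, euler R (c μ ν α) = c μ ν α)
    (hskew : ∀ μ ν α, c μ ν α = -c ν μ α)
    (hjac : ∀ μ ν α, ∑ ρ, (A μ ρ * c ρ ν α + A ν ρ * c μ ρ α - c μ ν ρ * A ρ α) = 0)
    (hψ0 : ∀ μ ν, X ∣ ψ μ ν - if μ = ν then 1 else 0) (hA0 : ∀ μ ν, X ∣ A μ ν) (μ ν γ : ι) :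
    curvature D c ψ μ ν γ = 0 := by
  have hdvd : ∀ i, ∀ μ ν γ, (X : R⟦X⟧) ^ i ∣ curvature D c ψ μ ν γ := by
    intro i
    induction i with
    | zero => simp
    | succ i ih =>
      intro μ ν γ
      set F := curvature D c ψ with hF
      have h : euler R (F μ ν γ) + F μ ν γ
          = ∑ ρ, ((A μ ρ - (ψ μ ρ - if μ = ρ then 1 else 0)) * F ρ ν γ
            + (A ν ρ - (ψ ν ρ - if ν = ρ then 1 else 0)) * F μ ρ γ
            - F μ ν ρ * (ψ ρ γ - if ρ = γ then 1 else 0)) := by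
        rw [hF, derivation_curvature (euler R) D hcomm c ψ A hψ hA hc hskew hjac]
        simp only [mul_sub, sub_mul, sum_add_distrib, sum_sub_distrib, ite_mul, mul_ite, one_mul,
          zero_mul, mul_one, mul_zero, sum_ite_eq, sum_ite_eq', mem_univ, if_true]
        ring
      have h' : (X : R⟦X⟧) ^ (i + 1) ∣ euler R (F μ ν γ) + F μ ν γ := by
        rw [h]
        refine dvd_sum fun ρ _ => dvd_sub (dvd_add ?_ ?_) ?_
        · rw [pow_succ']
          exact mul_dvd_mul (dvd_sub (hA0 _ _) (hψ0 _ _)) (ih _ _ _)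
        · rw [pow_succ']
          exact mul_dvd_mul (dvd_sub (hA0 _ _) (hψ0 _ _)) (ih _ _ _)
        · rw [pow_succ]
          exact mul_dvd_mul (ih _ _ _) (hψ0 _ _)
      rw [X_pow_dvd_iff] at h' ⊢
      intro j hj
      have hz := h' j hj
      rw [map_add, coeff_euler] at hz
      -- torsion-freeness of the coefficient ring allows to divide by `j + 1`
      have hz' : (j + 1) • coeff j (F μ ν γ) = 0 := by
        rw [nsmul_eq_mul]
        push_cast
        linear_combination hz
      exact (smul_eq_zero_iff_right (Nat.succ_ne_zero j)).1 hz'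
  ext i
  exact X_pow_dvd_iff.1 (hdvd (i + 1) μ ν γ) i i.lt_succ_self

end Curvature

/-! ### The matrix `ψ(𝒞)` over the polynomial ring -/

section LinearMatrix

variable {𝕜 : Type*} [Field 𝕜] {n : ℕ}

/-- The matrix `𝒞_μν = ∑_α C_μαν p_α` of linear forms in commuting variables `p_α`. -/
def polyMatrix (C : Fin n → Fin n → Fin n → 𝕜) :
    Matrix (Fin n) (Fin n) (MvPolynomial (Fin n) 𝕜) :=
  Matrix.of fun μ ν => ∑ α, C μ α ν • MvPolynomial.X α

/-- The term of degree `k` of the matrix `ψ(𝒞)` in commuting variables. -/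
def psiTerm (C : Fin n → Fin n → Fin n → 𝕜) (k : ℕ) :
    Matrix (Fin n) (Fin n) (MvPolynomial (Fin n) 𝕜) :=
  psiCoeff 𝕜 k • polyMatrix C ^ k

theorem isHomogeneous_polyMatrix_pow (C : Fin n → Fin n → Fin n → 𝕜) (k : ℕ) (μ ν : Fin n) :
    ((polyMatrix C ^ k) μ ν).IsHomogeneous k := by
  induction k generalizing ν with
  | zero =>
    rw [pow_zero, Matrix.one_apply]
    split_ifs
    · exact MvPolynomial.isHomogeneous_one _ _
    · exact MvPolynomial.isHomogeneous_zero _ _ _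
  | succ k ih =>
    rw [pow_succ, Matrix.mul_apply]
    refine MvPolynomial.IsHomogeneous.sum _ _ _ fun ρ _ => (ih ρ).mul ?_
    rw [polyMatrix, Matrix.of_apply]
    refine MvPolynomial.IsHomogeneous.sum _ _ _ fun α _ => ?_
    exact (MvPolynomial.homogeneousSubmodule (Fin n) 𝕜 1).smul_mem _
      (MvPolynomial.isHomogeneous_X _ _)

theorem isHomogeneous_psiTerm (C : Fin n → Fin n → Fin n → 𝕜) (k : ℕ) (μ ν : Fin n) :
    (psiTerm C k μ ν).IsHomogeneous k :=
  (MvPolynomial.homogeneousSubmodule (Fin n) 𝕜 k).smul_mem _ (isHomogeneous_polyMatrix_pow C k μ ν)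

theorem pderiv_polyMatrix (C : Fin n → Fin n → Fin n → 𝕜) (β μ ν : Fin n) :
    MvPolynomial.pderiv β (polyMatrix C μ ν) = MvPolynomial.C (C μ β ν) := by
  simp [polyMatrix, MvPolynomial.pderiv_X, Pi.single_apply, MvPolynomial.smul_eq_C_mul]

theorem pderiv_psiTerm_zero (C : Fin n → Fin n → Fin n → 𝕜) (β μ ν : Fin n) :
    MvPolynomial.pderiv β (psiTerm C 0 μ ν) = 0 := by
  rw [psiTerm, pow_zero, psiCoeff_zero, one_smul, Matrix.one_apply]
  split_ifs <;> simp

variable [CharZero 𝕜]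

theorem psiTerm_recursion (C : Fin n → Fin n → Fin n → 𝕜) (k : ℕ) :
    ((k + 1 : ℕ) : 𝕜) • psiTerm C (k + 1) = psiTerm C (k + 1) + polyMatrix C * psiTerm C k
      - ∑ p ∈ antidiagonal (k + 1), psiTerm C p.1 * psiTerm C p.2 := by
  have h : ∑ p ∈ antidiagonal (k + 1), psiTerm C p.1 * psiTerm C p.2
      = (∑ p ∈ antidiagonal (k + 1), psiCoeff 𝕜 p.1 * psiCoeff 𝕜 p.2)
        • polyMatrix C ^ (k + 1) := by
    rw [sum_smul]
    refine sum_congr rfl fun p hp => ?_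
    rw [psiTerm, psiTerm, smul_mul_smul_comm, ← pow_add, mem_antidiagonal.1 hp]
  rw [h, psiTerm, psiTerm, smul_smul, psiCoeff_recursion, mul_smul_comm, ← pow_succ', ← add_smul,
    ← sub_smul]

/-- In each degree, the identity saying that the vector fields `V_μ = ∑_α ψ(𝒞)_μα ∂/∂p_α`
satisfy `[V_μ, V_ν] = -∑_α C_μνα V_α`. -/
theorem psiTerm_bracket (C : Fin n → Fin n → Fin n → 𝕜)
    (hskew : ∀ μ ν α, C μ ν α = -C ν μ α)
    (hjac : ∀ μ ν κ α, ∑ ρ, (C μ κ ρ * C ρ ν α + C ν κ ρ * C μ ρ α - C μ ν ρ * C ρ κ α) = 0)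
    (μ ν γ : Fin n) (k : ℕ) :
    ∑ p ∈ antidiagonal (k + 1), ∑ β,
        (psiTerm C p.1 μ β * MvPolynomial.pderiv β (psiTerm C p.2 ν γ)
          - psiTerm C p.1 ν β * MvPolynomial.pderiv β (psiTerm C p.2 μ γ))
      + ∑ α, C μ ν α • psiTerm C k α γ = 0 := by
  have hpoly : ∀ μ ν α, ∑ ρ, (polyMatrix C μ ρ * MvPolynomial.C (C ρ ν α)
      + polyMatrix C ν ρ * MvPolynomial.C (C μ ρ α)
      - MvPolynomial.C (C μ ν ρ) * polyMatrix C ρ α) = 0 := fun μ ν α => by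
    have h : ∀ ρ, polyMatrix C μ ρ * MvPolynomial.C (C ρ ν α)
        + polyMatrix C ν ρ * MvPolynomial.C (C μ ρ α)
        - MvPolynomial.C (C μ ν ρ) * polyMatrix C ρ α
        = ∑ κ, MvPolynomial.C (C μ κ ρ * C ρ ν α + C ν κ ρ * C μ ρ α - C μ ν ρ * C ρ κ α)
          * MvPolynomial.X κ := fun ρ => by
      simp only [polyMatrix, Matrix.of_apply, sum_mul, mul_sum, ← sum_add_distrib,
        ← sum_sub_distrib]
      refine sum_congr rfl fun κ _ => ?_
      simp only [MvPolynomial.smul_eq_C_mul, map_add, map_sub, map_mul]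
      ring
    rw [sum_congr rfl fun ρ _ => h ρ, sum_comm]
    refine sum_eq_zero fun κ _ => ?_
    rw [← sum_mul, ← map_sum, hjac, map_zero, zero_mul]
  have h := curvature_eq_zero (R := MvPolynomial (Fin n) 𝕜)
    (D := fun β => PowerSeries.mapCoeffs (MvPolynomial.pderiv (R := 𝕜) β))
    (c := fun μ ν α => PowerSeries.X * PowerSeries.C (MvPolynomial.C (C μ ν α)))
    (ψ := fun μ ν => PowerSeries.mk fun k => psiTerm C k μ ν)
    (A := fun μ ν => PowerSeries.X * PowerSeries.C (polyMatrix C μ ν))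
    (fun β f => PowerSeries.euler_mapCoeffs _ f)
    (fun μ ν => by
      ext1 k
      cases k with
      | zero =>
        simp [psiTerm, psiCoeff_zero, sub_mul, Matrix.one_apply]
      | succ k =>
        have h := congrFun (congrFun (psiTerm_recursion C k) μ) ν
        simp only [sub_mul, mul_assoc, sum_sub_distrib, map_add, map_sub, map_sum,
          PowerSeries.coeff_succ_X_mul, PowerSeries.coeff_C_mul, PowerSeries.coeff_mk,
          PowerSeries.coeff_euler]
        simp only [PowerSeries.coeff_mul, PowerSeries.coeff_mk]
        rw [sum_comm (s := univ) (t := antidiagonal (k + 1))]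
        simp only [Matrix.sub_apply, Matrix.add_apply, Matrix.smul_apply, Matrix.sum_apply,
          Matrix.mul_apply] at h
        rw [Nat.cast_smul_eq_nsmul, nsmul_eq_mul] at h
        rw [h, add_sub_assoc])
    (fun β μ ν => by
      ext1 k
      cases k with
      | zero =>
        rw [PowerSeries.coeff_mapCoeffs, PowerSeries.coeff_zero_X_mul,
          PowerSeries.coeff_zero_X_mul, map_zero]
      | succ k =>
        rw [PowerSeries.coeff_mapCoeffs, PowerSeries.coeff_succ_X_mul,
          PowerSeries.coeff_succ_X_mul, PowerSeries.coeff_C, PowerSeries.coeff_C]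
        split_ifs
        · exact pderiv_polyMatrix C β μ ν
        · exact map_zero _)
    (fun μ ν α => by
      ext1 k
      rw [PowerSeries.coeff_euler]
      rcases k with _ | _ | k
      · simp
      · simp
      · rw [PowerSeries.coeff_succ_X_mul, PowerSeries.coeff_C, if_neg k.succ_ne_zero, mul_zero])
    (fun μ ν α => by rw [hskew μ ν α, map_neg, map_neg, mul_neg])
    (fun μ ν α => by
      have h := hpoly μ ν α
      have h2 := congrArg (fun f => PowerSeries.X * (PowerSeries.X * PowerSeries.C f)) h
      simp only [map_sum, map_sub, map_add, map_mul, mul_sum, map_zero, mul_zero] at h2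
      rw [← h2]
      exact sum_congr rfl fun ρ _ => by ring)
    (fun μ ν => by
      rw [PowerSeries.X_dvd_iff]
      split_ifs with h <;> simp [psiTerm, psiCoeff_zero, h])
    (fun μ ν => dvd_mul_right _ _) μ ν γ
  have hk := congrArg (PowerSeries.coeff (k + 1)) h
  simp only [curvature, mul_assoc, map_add, map_sub, map_sum, PowerSeries.coeff_succ_X_mul,
    PowerSeries.coeff_C_mul, PowerSeries.coeff_mk, map_zero] at hk
  simp only [PowerSeries.coeff_mul, PowerSeries.coeff_mk, PowerSeries.coeff_mapCoeffs] at hk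
  rw [← hk]
  simp only [sum_sub_distrib, MvPolynomial.smul_eq_C_mul]
  rw [sum_comm, sum_comm (s := antidiagonal (k + 1))]

end LinearMatrix

/-! ### Computations in the Weyl superalgebra -/

namespace WeylSuper

variable (𝕜 : Type*) [Field 𝕜] {n m : ℕ}

theorem commute_gen (s t : WeylGen n m) (h : s.parity = 0 ∨ t.parity = 0)
    (h' : WeylGen.pairing 𝕜 s t = 0) : Commute (gen 𝕜 s) (gen 𝕜 t) := by
  have h1 := gen_rel 𝕜 s t
  have h2 : s.parity.val * t.parity.val = 0 := by rcases h with h | h <;> simp [h]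
  rwa [h', h2, pow_zero, one_smul, map_zero, sub_eq_zero] at h1

theorem gen_d_mul_x (α β : Fin n) :
    gen 𝕜 (.d α : WeylGen n m) * gen 𝕜 (.x β)
      = gen 𝕜 (.x β) * gen 𝕜 (.d α) + if α = β then 1 else 0 := by
  have h := gen_rel 𝕜 (.d α : WeylGen n m) (.x β)
  simp only [WeylGen.parity, WeylGen.pairing, ZMod.val_zero, mul_zero, pow_zero, one_smul] at h
  rw [sub_eq_iff_eq_add'] at h
  rw [h]
  split_ifs <;> simp

theorem gen_q_mul_xi (a b : Fin m) :
    gen 𝕜 (.q a : WeylGen n m) * gen 𝕜 (.xi b)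
      = (if a = b then 1 else 0) - gen 𝕜 (.xi b) * gen 𝕜 (.q a) := by
  have h := gen_rel 𝕜 (.q a : WeylGen n m) (.xi b)
  simp only [WeylGen.parity, WeylGen.pairing, ZMod.val_one, mul_one, pow_one, neg_smul,
    one_smul, sub_neg_eq_add] at h
  rw [eq_sub_iff_add_eq, h]
  split_ifs <;> simp

theorem gen_xi_mul_xi (a b : Fin m) :
    gen 𝕜 (.xi a : WeylGen n m) * gen 𝕜 (.xi b) = -(gen 𝕜 (.xi b) * gen 𝕜 (.xi a)) := by
  have h := gen_rel 𝕜 (.xi a : WeylGen n m) (.xi b)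
  simp only [WeylGen.parity, WeylGen.pairing, ZMod.val_one, mul_one, pow_one, neg_smul,
    one_smul, sub_neg_eq_add, map_zero] at h
  exact eq_neg_of_add_eq_zero_left h

theorem gen_q_mul_q (a b : Fin m) :
    gen 𝕜 (.q a : WeylGen n m) * gen 𝕜 (.q b) = -(gen 𝕜 (.q b) * gen 𝕜 (.q a)) := by
  have h := gen_rel 𝕜 (.q a : WeylGen n m) (.q b)
  simp only [WeylGen.parity, WeylGen.pairing, ZMod.val_one, mul_one, pow_one, neg_smul,
    one_smul, sub_neg_eq_add, map_zero] at h
  exact eq_neg_of_add_eq_zero_left h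

theorem isMulCommutative_adjoin_d :
    IsMulCommutative (Algebra.adjoin 𝕜 (Set.range fun α : Fin n => gen 𝕜 (.d α : WeylGen n m))) :=
  Algebra.isMulCommutative_adjoin 𝕜 <| by
    rintro _ ⟨α, rfl⟩ _ ⟨β, rfl⟩
    exact commute_gen 𝕜 _ _ (Or.inl rfl) rfl

open scoped IsMulCommutative in
variable (m) in
/-- Substitution of the commuting elements `∂_α` for the variables of a polynomial. It is
evaluated in the commutative subalgebra generated by the `∂_α`. -/
def dEval : MvPolynomial (Fin n) 𝕜 →ₐ[𝕜] WeylSuper 𝕜 n m :=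
  haveI := isMulCommutative_adjoin_d 𝕜 (n := n) (m := m)
  (Algebra.adjoin 𝕜 (Set.range fun α : Fin n => gen 𝕜 (.d α : WeylGen n m))).val.comp
    (MvPolynomial.aeval (R := 𝕜) (S₁ := ↥(Algebra.adjoin 𝕜
      (Set.range fun α : Fin n => gen 𝕜 (.d α : WeylGen n m)))) fun α =>
        ⟨gen 𝕜 (.d α), Algebra.subset_adjoin ⟨α, rfl⟩⟩)

@[simp]
theorem dEval_X (α : Fin n) : dEval 𝕜 m (MvPolynomial.X α) = gen 𝕜 (.d α) := by
  simp [dEval]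

@[simp]
theorem dEval_C (c : 𝕜) :
    dEval 𝕜 m (MvPolynomial.C c : MvPolynomial (Fin n) 𝕜) = algebraMap 𝕜 _ c :=
  (dEval 𝕜 m).commutes c

theorem commute_dEval (p : MvPolynomial (Fin n) 𝕜) (a : WeylSuper 𝕜 n m)
    (h : ∀ α, Commute (gen 𝕜 (.d α)) a) : Commute (dEval 𝕜 m p) a := by
  induction p using MvPolynomial.induction_on with
  | C c => rw [dEval_C]; exact Algebra.commutes c a
  | add p r hp hr => rw [map_add]; exact hp.add_left hr
  | mul_X p α hp => rw [map_mul, dEval_X]; exact hp.mul_left (h α)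

theorem dEval_mul_x (p : MvPolynomial (Fin n) 𝕜) (β : Fin n) :
    dEval 𝕜 m p * gen 𝕜 (.x β)
      = gen 𝕜 (.x β) * dEval 𝕜 m p + dEval 𝕜 m (MvPolynomial.pderiv β p) := by
  induction p using MvPolynomial.induction_on with
  | C c => rw [dEval_C, MvPolynomial.pderiv_C, map_zero, add_zero]; exact Algebra.commutes c _
  | add p r hp hr => simp only [map_add, add_mul, mul_add, hp, hr]; abel
  | mul_X p α hp =>
    have h : dEval 𝕜 m (MvPolynomial.pderiv β (MvPolynomial.X α : MvPolynomial (Fin n) 𝕜))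
        = if α = β then 1 else 0 := by
      rw [MvPolynomial.pderiv_X, Pi.single_apply]
      split_ifs <;> simp
    rw [Derivation.leibniz, map_add, smul_eq_mul, smul_eq_mul, map_mul, map_mul, map_mul,
      mul_assoc, dEval_X, gen_d_mul_x, mul_add, ← mul_assoc, hp, h, add_mul, mul_assoc,
      (commute_dEval 𝕜 (MvPolynomial.pderiv β p) (gen 𝕜 (.d α)) fun γ =>
        commute_gen 𝕜 _ _ (Or.inl rfl) rfl).eq]
    abel

theorem dEval_mem_filtration {p : MvPolynomial (Fin n) 𝕜} {k : ℕ} (hp : p.IsHomogeneous k) :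
    dEval 𝕜 m p ∈ filtration 𝕜 n m k := by
  have h1 : (MvPolynomial.homogeneousSubmodule (Fin n) 𝕜 1).map (dEval 𝕜 m).toLinearMap
      ≤ lowering 𝕜 n m := by
    rw [MvPolynomial.homogeneousSubmodule_one_eq_span_X, Submodule.map_span_le]
    rintro _ ⟨α, rfl⟩
    exact Submodule.subset_span ⟨.d α, trivial, dEval_X 𝕜 α⟩
  have h2 : dEval 𝕜 m p ∈ lowering 𝕜 n m ^ k := by
    refine pow_le_pow_left' h1 k ?_
    rw [← Submodule.map_pow, MvPolynomial.homogeneousSubmodule_one_pow]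
    exact ⟨p, hp, rfl⟩
  have h3 := Submodule.mul_mem_mul (Submodule.mem_top (R := 𝕜) (x := (1 : WeylSuper 𝕜 n m))) h2
  rwa [one_mul] at h3

variable (m) in
/-- The element `∑_α x_α u_α(∂)`, linear in the `x_α`. -/
def xLinear (u : Fin n → MvPolynomial (Fin n) 𝕜) : WeylSuper 𝕜 n m :=
  ∑ α, gen 𝕜 (.x α) * dEval 𝕜 m (u α)

/-- Commutators of elements `∑_α x_α u_α(∂)` are those of the vector fields
`-∑_α u_α(p) ∂/∂p_α`. -/
theorem xLinear_commutator (u v : Fin n → MvPolynomial (Fin n) 𝕜) :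
    xLinear 𝕜 m u * xLinear 𝕜 m v - xLinear 𝕜 m v * xLinear 𝕜 m u
      = -xLinear 𝕜 m fun γ => ∑ β, (u β * MvPolynomial.pderiv β (v γ)
          - v β * MvPolynomial.pderiv β (u γ)) := by
  have h : ∀ u v : Fin n → MvPolynomial (Fin n) 𝕜, xLinear 𝕜 m u * xLinear 𝕜 m v
      = ∑ α, ∑ β, gen 𝕜 (.x α) * gen 𝕜 (.x β) * dEval 𝕜 m (u α * v β)
        + xLinear 𝕜 m fun γ => ∑ β, v β * MvPolynomial.pderiv β (u γ) := fun u v => by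
    simp only [xLinear]
    rw [sum_mul_sum]
    simp only [map_sum, mul_sum, ← sum_add_distrib]
    refine sum_congr rfl fun α _ => sum_congr rfl fun β _ => ?_
    rw [mul_comm (v β), map_mul, map_mul, mul_assoc, ← mul_assoc (dEval 𝕜 m (u α)), dEval_mul_x]
    noncomm_ring
  have hs : ∑ α, ∑ β, gen 𝕜 (.x α : WeylGen n m) * gen 𝕜 (.x β) * dEval 𝕜 m (u α * v β)
      = ∑ α, ∑ β, gen 𝕜 (.x α) * gen 𝕜 (.x β) * dEval 𝕜 m (v α * u β) := by
    rw [sum_comm]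
    refine sum_congr rfl fun α _ => sum_congr rfl fun β _ => ?_
    rw [mul_comm (v α),
      (commute_gen 𝕜 (.x β : WeylGen n m) (.x α) (Or.inl rfl) rfl).eq]
  rw [h, h, hs]
  simp only [xLinear, sum_sub_distrib, map_sub, mul_sub]
  abel

variable (n) in
/-- The element `∑_{a,b} A_ab ξ_a q_b` of the Weyl superalgebra. -/
def fermi : Matrix (Fin m) (Fin m) 𝕜 →ₗ[𝕜] WeylSuper 𝕜 n m where
  toFun A := ∑ a, ∑ b, A a b • (gen 𝕜 (.xi a) * gen 𝕜 (.q b))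
  map_add' A B := by simp only [Matrix.add_apply, add_smul, sum_add_distrib]
  map_smul' c A := by
    simp only [Matrix.smul_apply, smul_eq_mul, mul_smul, smul_sum, RingHom.id_apply]

theorem fermi_apply (A : Matrix (Fin m) (Fin m) 𝕜) :
    fermi 𝕜 n A = ∑ a, ∑ b, A a b • (gen 𝕜 (.xi a) * gen 𝕜 (.q b)) := rfl

theorem fermi_mul_xi (A : Matrix (Fin m) (Fin m) 𝕜) (c : Fin m) :
    fermi 𝕜 n A * gen 𝕜 (.xi c)
      = ∑ a, A a c • gen 𝕜 (.xi a) + gen 𝕜 (.xi c) * fermi 𝕜 n A := by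
  have h : ∀ a b : Fin m, gen 𝕜 (.xi a : WeylGen n m) * gen 𝕜 (.q b) * gen 𝕜 (.xi c)
      = (if b = c then gen 𝕜 (.xi a) else 0)
        + gen 𝕜 (.xi c) * (gen 𝕜 (.xi a) * gen 𝕜 (.q b)) := fun a b => by
    rw [mul_assoc, gen_q_mul_xi, mul_sub, ← mul_assoc, gen_xi_mul_xi 𝕜 a c]
    split_ifs <;> noncomm_ring
  simp only [fermi_apply, sum_mul, mul_sum, smul_mul_assoc, h, smul_add, sum_add_distrib,
    mul_smul_comm, smul_ite, smul_zero, sum_ite_eq', mem_univ, if_true]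

theorem fermi_commutator (A B : Matrix (Fin m) (Fin m) 𝕜) :
    fermi 𝕜 n A * fermi 𝕜 n B - fermi 𝕜 n B * fermi 𝕜 n A = fermi 𝕜 n (A * B - B * A) := by
  have h : ∀ A B : Matrix (Fin m) (Fin m) 𝕜, fermi 𝕜 n A * fermi 𝕜 n B = fermi 𝕜 n (A * B)
      + ∑ c, ∑ d, ∑ a, ∑ b, (B c d * A a b) •
        (gen 𝕜 (.xi c) * (gen 𝕜 (.xi a) * (gen 𝕜 (.q b) * gen 𝕜 (.q d)))) := fun A B => by
    have h1 : fermi 𝕜 n (A * B)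
        = ∑ c, ∑ d, B c d • ∑ a, A a c • (gen 𝕜 (.xi a : WeylGen n m) * gen 𝕜 (.q d)) := by
      simp only [fermi_apply, Matrix.mul_apply, sum_smul, smul_sum, smul_smul]
      rw [sum_comm_cycle]
      refine sum_congr rfl fun c _ => ?_
      rw [sum_comm]
      simp only [mul_comm]
    rw [h1, fermi_apply 𝕜 B, mul_sum, ← sum_add_distrib]
    refine sum_congr rfl fun c _ => ?_
    rw [mul_sum, ← sum_add_distrib]
    refine sum_congr rfl fun d _ => ?_
    rw [mul_smul_comm, ← mul_assoc, fermi_mul_xi, add_mul, smul_add, sum_mul]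
    simp only [fermi_apply, mul_sum, sum_mul, smul_sum, smul_mul_assoc, mul_smul_comm, smul_smul,
      mul_assoc]
  have hs : ∑ c, ∑ d, ∑ a, ∑ b, (B c d * A a b) •
      (gen 𝕜 (.xi c : WeylGen n m) * (gen 𝕜 (.xi a) * (gen 𝕜 (.q b) * gen 𝕜 (.q d))))
      = ∑ c, ∑ d, ∑ a, ∑ b, (A c d * B a b) •
        (gen 𝕜 (.xi c) * (gen 𝕜 (.xi a) * (gen 𝕜 (.q b) * gen 𝕜 (.q d)))) := by
    have hf : ∀ f : Fin m → Fin m → Fin m → Fin m → WeylSuper 𝕜 n m,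
        ∑ c, ∑ d, ∑ a, ∑ b, f c d a b = ∑ c, ∑ d, ∑ a, ∑ b, f a b c d := fun f => by
      have h2 := sum_comm (s := univ) (t := univ)
        (f := fun x y : Fin m × Fin m => f x.1 x.2 y.1 y.2)
      simpa only [Fintype.sum_prod_type] using h2
    rw [hf]
    refine sum_congr rfl fun c _ => sum_congr rfl fun d _ => sum_congr rfl fun a _ =>
      sum_congr rfl fun b _ => ?_
    rw [mul_comm (B a b), gen_q_mul_q 𝕜 d b, ← mul_assoc, gen_xi_mul_xi 𝕜 a c, neg_mul_neg,
      mul_assoc]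
  rw [h, h, hs, map_sub]
  abel

theorem commute_xLinear_fermi (u : Fin n → MvPolynomial (Fin n) 𝕜)
    (A : Matrix (Fin m) (Fin m) 𝕜) : Commute (xLinear 𝕜 m u) (fermi 𝕜 n A) := by
  rw [fermi_apply]
  refine Commute.sum_left _ _ _ fun α _ => Commute.sum_right _ _ _ fun a _ =>
    Commute.sum_right _ _ _ fun b _ => Commute.smul_right (Commute.mul_left ?_ ?_) _
  · exact (commute_gen 𝕜 _ _ (Or.inl rfl) rfl).mul_right (commute_gen 𝕜 _ _ (Or.inl rfl) rfl)
  · exact commute_dEval 𝕜 _ _ fun γ =>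
      (commute_gen 𝕜 _ _ (Or.inl rfl) rfl).mul_right (commute_gen 𝕜 _ _ (Or.inl rfl) rfl)

theorem commute_xLinear_xi (u : Fin n → MvPolynomial (Fin n) 𝕜) (a : Fin m) :
    Commute (xLinear 𝕜 m u) (gen 𝕜 (.xi a)) :=
  Commute.sum_left _ _ _ fun _ _ => Commute.mul_left (commute_gen 𝕜 _ _ (Or.inl rfl) rfl)
    (commute_dEval 𝕜 _ _ fun _ => commute_gen 𝕜 _ _ (Or.inl rfl) rfl)

/-! ### Parity -/

theorem gen_mem_part (s : WeylGen n m) : gen 𝕜 s ∈ part 𝕜 n m s.parity :=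
  Submodule.subset_span ⟨[s], by simp⟩

theorem algebraMap_mem_part (c : 𝕜) : algebraMap 𝕜 _ c ∈ part 𝕜 n m 0 := by
  rw [Algebra.algebraMap_eq_smul_one]
  exact Submodule.smul_mem _ _ (Submodule.subset_span ⟨[], by simp⟩)

theorem mul_mem_part {i j l : ZMod 2} (hl : i + j = l) {a b : WeylSuper 𝕜 n m}
    (ha : a ∈ part 𝕜 n m i) (hb : b ∈ part 𝕜 n m j) : a * b ∈ part 𝕜 n m l := by
  have h := Submodule.mul_mem_mul ha hb
  rw [part, part, Submodule.span_mul_span] at h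
  refine Submodule.span_mono ?_ h
  rintro _ ⟨_, ⟨l, rfl, rfl⟩, _, ⟨l', rfl, rfl⟩, rfl⟩
  exact ⟨l ++ l', by simpa using hl, by simp⟩

theorem dEval_mem_part (p : MvPolynomial (Fin n) 𝕜) : dEval 𝕜 m p ∈ part 𝕜 n m 0 := by
  induction p using MvPolynomial.induction_on with
  | C c => rw [dEval_C]; exact algebraMap_mem_part 𝕜 c
  | add p r hp hr => rw [map_add]; exact add_mem hp hr
  | mul_X p α hp =>
    rw [map_mul, dEval_X]
    exact mul_mem_part 𝕜 (add_zero 0) hp (gen_mem_part 𝕜 (.d α))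

theorem xLinear_mem_part (u : Fin n → MvPolynomial (Fin n) 𝕜) :
    xLinear 𝕜 m u ∈ part 𝕜 n m 0 :=
  sum_mem fun α _ =>
    mul_mem_part 𝕜 (add_zero 0) (gen_mem_part 𝕜 (.x α)) (dEval_mem_part 𝕜 (u α))

theorem fermi_mem_part (A : Matrix (Fin m) (Fin m) 𝕜) : fermi 𝕜 n A ∈ part 𝕜 n m 0 := by
  rw [fermi_apply]
  exact sum_mem fun a _ => sum_mem fun b _ => Submodule.smul_mem _ _
    (mul_mem_part 𝕜 (by decide : (1 : ZMod 2) + 1 = 0) (gen_mem_part 𝕜 (.xi a))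
      (gen_mem_part 𝕜 (.q b)))

end WeylSuper

/-! ### Truncations of the series and their limits -/

section Truncation

variable {𝕜 : Type*} [Field 𝕜] {n : ℕ} (m : ℕ)

/-- The entries of the matrix `ψ(𝒞)` in commuting variables, truncated in degrees above `N`. -/
def psiTrunc (C : Fin n → Fin n → Fin n → 𝕜) (N : ℕ) (μ α : Fin n) : MvPolynomial (Fin n) 𝕜 :=
  ∑ k ∈ range (N + 1), psiTerm C k μ α

open WeylSuper

/-- For the truncated series the bracket identity holds up to terms of degree at least `N`: those
`(i, j)` with `i + j ≤ N` cancel by `psiTerm_bracket`. -/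
theorem dEval_psiTrunc_mem_filtration [CharZero 𝕜] (C : Fin n → Fin n → Fin n → 𝕜)
    (hskew : ∀ μ ν α, C μ ν α = -C ν μ α)
    (hjac : ∀ μ ν κ α, ∑ ρ, (C μ κ ρ * C ρ ν α + C ν κ ρ * C μ ρ α - C μ ν ρ * C ρ κ α) = 0)
    (N : ℕ) (μ ν γ : Fin n) :
    dEval 𝕜 m (∑ β, (psiTrunc C N μ β * MvPolynomial.pderiv β (psiTrunc C N ν γ)
        - psiTrunc C N ν β * MvPolynomial.pderiv β (psiTrunc C N μ γ))
      + ∑ α, C μ ν α • psiTrunc C N α γ) ∈ filtration 𝕜 n m N := by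
  set f : ℕ × ℕ → MvPolynomial (Fin n) 𝕜 := fun p => ∑ β,
    (psiTerm C p.1 μ β * MvPolynomial.pderiv β (psiTerm C p.2 ν γ)
      - psiTerm C p.1 ν β * MvPolynomial.pderiv β (psiTerm C p.2 μ γ)) with hf
  set s := range (N + 1) ×ˢ range (N + 1) with hs
  have h1 : ∑ β, (psiTrunc C N μ β * MvPolynomial.pderiv β (psiTrunc C N ν γ)
      - psiTrunc C N ν β * MvPolynomial.pderiv β (psiTrunc C N μ γ)) = ∑ p ∈ s, f p := by
    rw [hf, sum_comm]
    refine sum_congr rfl fun β _ => ?_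
    simp only [psiTrunc, map_sum, sum_mul_sum, hs, sum_product, sum_sub_distrib]
  have h2 : ∑ p ∈ s with p.1 + p.2 ≤ N, f p
      = ∑ k ∈ range N, ∑ p ∈ antidiagonal (k + 1), f p := by
    have h0 : ∑ p ∈ antidiagonal 0, f p = 0 := by
      simp [hf, pderiv_psiTerm_zero]
    rw [← add_zero (∑ k ∈ range N, _), ← h0,
      ← sum_range_succ' fun k => ∑ p ∈ antidiagonal k, f p,
      ← sum_fiberwise_of_maps_to (t := range (N + 1)) (g := fun p : ℕ × ℕ => p.1 + p.2)]
    · refine sum_congr rfl fun k hk => sum_congr ?_ fun _ _ => rfl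
      ext p
      simp only [hs, mem_filter, mem_product, mem_range,
        HasAntidiagonal.mem_antidiagonal] at hk ⊢
      omega
    · intro p hp
      rw [mem_filter] at hp
      exact mem_range.2 (Nat.lt_succ_of_le hp.2)
  have h3 : ∑ α, C μ ν α • psiTrunc C N α γ = ∑ k ∈ range N, ∑ α, C μ ν α • psiTerm C k α γ
      + ∑ α, C μ ν α • psiTerm C N α γ := by
    rw [← sum_range_succ fun k => ∑ α, C μ ν α • psiTerm C k α γ, sum_comm]
    simp only [psiTrunc, smul_sum]
  have h4 : ∑ k ∈ range N, ∑ p ∈ antidiagonal (k + 1), f p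
      + ∑ k ∈ range N, ∑ α, C μ ν α • psiTerm C k α γ = 0 := by
    rw [← sum_add_distrib]
    exact sum_eq_zero fun k _ => psiTerm_bracket C hskew hjac μ ν γ k
  have h5 : ∑ p ∈ s, f p + ∑ α, C μ ν α • psiTrunc C N α γ
      = ∑ p ∈ s with ¬ p.1 + p.2 ≤ N, f p + ∑ α, C μ ν α • psiTerm C N α γ := by
    rw [← sum_filter_add_sum_filter_not s fun p => p.1 + p.2 ≤ N, h2, h3]
    linear_combination h4
  have hterm : ∀ i j, N ≤ i + (j - 1) → ∀ μ ν β γ,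
      dEval 𝕜 m (psiTerm C i μ β * MvPolynomial.pderiv β (psiTerm C j ν γ))
        ∈ filtration 𝕜 n m N := fun i j hij μ ν β γ =>
    filtration_antitone 𝕜 n m hij (dEval_mem_filtration 𝕜
      ((isHomogeneous_psiTerm C i μ β).mul (isHomogeneous_psiTerm C j ν γ).pderiv))
  rw [h1, h5, map_add, map_sum, map_sum]
  refine add_mem (sum_mem fun p hp => ?_) (sum_mem fun α _ => ?_)
  · rw [mem_filter] at hp
    rw [hf, map_sum]
    refine sum_mem fun β _ => ?_
    rw [map_sub]
    exact sub_mem (hterm _ _ (by omega) _ _ _ _) (hterm _ _ (by omega) _ _ _ _)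
  · rw [map_smul]
    exact Submodule.smul_mem _ _ (dEval_mem_filtration 𝕜 (isHomogeneous_psiTerm C N α γ))

/-- The element `∑_α x_α ψ(𝒞)_μα - ∑_{a,b} (M_μ)_ab ξ_a q_b`, with the series `ψ(𝒞)`
truncated in degrees above `N`. -/
def truncImage (C : Fin n → Fin n → Fin n → 𝕜) (M : Fin n → Matrix (Fin m) (Fin m) 𝕜) (N : ℕ)
    (μ : Fin n) : WeylSuper 𝕜 n m :=
  xLinear 𝕜 m (psiTrunc C N μ) - fermi 𝕜 n (M μ)

variable {m}

theorem truncImage_commutator_mem_filtration [CharZero 𝕜] (C : Fin n → Fin n → Fin n → 𝕜)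
    (M : Fin n → Matrix (Fin m) (Fin m) 𝕜) (hskew : ∀ μ ν α, C μ ν α = -C ν μ α)
    (hjac : ∀ μ ν κ α, ∑ ρ, (C μ κ ρ * C ρ ν α + C ν κ ρ * C μ ρ α - C μ ν ρ * C ρ κ α) = 0)
    (hM : ∀ μ ν, M μ * M ν - M ν * M μ = -∑ α, C μ ν α • M α) (N : ℕ) (μ ν : Fin n) :
    truncImage m C M N μ * truncImage m C M N ν - truncImage m C M N ν * truncImage m C M N μ
      - ∑ α, C μ ν α • truncImage m C M N α ∈ filtration 𝕜 n m N := by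
  have h : truncImage m C M N μ * truncImage m C M N ν
      - truncImage m C M N ν * truncImage m C M N μ - ∑ α, C μ ν α • truncImage m C M N α
      = -∑ γ, gen 𝕜 (.x γ) *
        dEval 𝕜 m (∑ β, (psiTrunc C N μ β * MvPolynomial.pderiv β (psiTrunc C N ν γ)
          - psiTrunc C N ν β * MvPolynomial.pderiv β (psiTrunc C N μ γ))
        + ∑ α, C μ ν α • psiTrunc C N α γ) := by
    have hx := xLinear_commutator 𝕜 (m := m) (psiTrunc C N μ) (psiTrunc C N ν)
    have hf := fermi_commutator 𝕜 (n := n) (M μ) (M ν)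
    have hc1 := (commute_xLinear_fermi 𝕜 (psiTrunc C N μ) (M ν)).eq
    have hc2 := (commute_xLinear_fermi 𝕜 (psiTrunc C N ν) (M μ)).eq
    have hsum : ∑ γ, gen 𝕜 (.x γ) * dEval 𝕜 m (∑ α, C μ ν α • psiTrunc C N α γ)
        = ∑ α, C μ ν α • xLinear 𝕜 m (psiTrunc C N α) := by
      simp only [xLinear, map_sum, map_smul, mul_sum, smul_sum, mul_smul_comm]
      exact sum_comm
    rw [hM, map_neg, map_sum] at hf
    simp only [map_smul] at hf
    have hR : -∑ γ, gen 𝕜 (.x γ) *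
          dEval 𝕜 m (∑ β, (psiTrunc C N μ β * MvPolynomial.pderiv β (psiTrunc C N ν γ)
            - psiTrunc C N ν β * MvPolynomial.pderiv β (psiTrunc C N μ γ))
          + ∑ α, C μ ν α • psiTrunc C N α γ)
        = xLinear 𝕜 m (psiTrunc C N μ) * xLinear 𝕜 m (psiTrunc C N ν)
          - xLinear 𝕜 m (psiTrunc C N ν) * xLinear 𝕜 m (psiTrunc C N μ)
          - ∑ α, C μ ν α • xLinear 𝕜 m (psiTrunc C N α) := by
      rw [hx, ← hsum]
      simp only [xLinear, map_add, mul_add, sum_add_distrib]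
      abel
    rw [hR]
    simp only [truncImage, smul_sub, sum_sub_distrib, sub_mul, mul_sub]
    linear_combination (norm := abel) hf - hc1 + hc2
  rw [h]
  exact neg_mem (sum_mem fun γ _ => mul_mem_filtration 𝕜 n m N _ _
    (dEval_psiTrunc_mem_filtration m C hskew hjac N μ ν γ))

theorem truncImage_mul_xi (C : Fin n → Fin n → Fin n → 𝕜)
    (M : Fin n → Matrix (Fin m) (Fin m) 𝕜) (N : ℕ) (μ : Fin n) (a : Fin m) :
    gen 𝕜 (.xi a) * truncImage m C M N μ - truncImage m C M N μ * gen 𝕜 (.xi a)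
      = ∑ b, M μ b a • gen 𝕜 (.xi b) := by
  rw [truncImage, sub_mul, mul_sub, fermi_mul_xi, (commute_xLinear_xi 𝕜 _ a).eq]
  abel

theorem truncImage_mem_part (C : Fin n → Fin n → Fin n → 𝕜)
    (M : Fin n → Matrix (Fin m) (Fin m) 𝕜) (N : ℕ) (μ : Fin n) :
    truncImage m C M N μ ∈ part 𝕜 n m 0 :=
  sub_mem (xLinear_mem_part 𝕜 _) (fermi_mem_part 𝕜 _)

end Truncation

section Completion

variable {𝕜 : Type*} [Field 𝕜] {n m : ℕ}

open WeylSuper Filter Topology UniformSpace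

theorem matC_pow_apply (C : Fin n → Fin n → Fin n → 𝕜) (k : ℕ) (μ ν : Fin n) :
    (matC m C ^ k) μ ν = (dEval 𝕜 m ((polyMatrix C ^ k) μ ν) : WeylSuperHat 𝕜 n m) := by
  let e : MvPolynomial (Fin n) 𝕜 →+* WeylSuperHat 𝕜 n m :=
    (Completion.coeRingHom (α := WeylSuper 𝕜 n m)).comp (dEval 𝕜 m).toRingHom
  have h : matC m C = e.mapMatrix (polyMatrix C) := by
    ext μ ν
    change _ = Completion.coeRingHom (dEval 𝕜 m (∑ α, C μ α ν • MvPolynomial.X α))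
    simp only [map_sum, map_smul, dEval_X, matC, Matrix.of_apply]
    exact sum_congr rfl fun α _ => (Completion.coe_smul _ _).symm
  rw [h, ← map_pow]
  rfl

theorem psiCoeff_smul_matC_pow (C : Fin n → Fin n → Fin n → 𝕜) (k : ℕ) (μ ν : Fin n) :
    psiCoeff 𝕜 k • (matC m C ^ k) μ ν
      = (dEval 𝕜 m (psiTerm C k μ ν) : WeylSuperHat 𝕜 n m) := by
  rw [matC_pow_apply, ← Completion.coe_smul, ← map_smul]
  rfl

theorem tendsto_coe_of_mem_filtration {a : ℕ → WeylSuper 𝕜 n m}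
    (ha : ∀ k, a k ∈ filtration 𝕜 n m k) :
    Tendsto (fun k => (a k : WeylSuperHat 𝕜 n m)) atTop (𝓝 0) := by
  have h : Tendsto a atTop (𝓝 0) := by
    rw [(ringSubgroupsBasis 𝕜 n m).hasBasis_nhds_zero.tendsto_right_iff]
    intro i _
    filter_upwards [eventually_ge_atTop i] with k hk
    exact filtration_antitone 𝕜 n m hk (ha k)
  exact (Completion.continuous_coe (WeylSuper 𝕜 n m)).continuousAt.tendsto.comp h

instance : NonarchimedeanRing (WeylSuper 𝕜 n m) := (ringSubgroupsBasis 𝕜 n m).nonarchimedean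

theorem summable_psiCoeff_smul_matC_pow (C : Fin n → Fin n → Fin n → 𝕜) (μ ν : Fin n) :
    Summable fun k : ℕ => psiCoeff 𝕜 k • (matC m C ^ k) μ ν := by
  refine NonarchimedeanAddGroup.summable_of_tendsto_cofinite_zero ?_
  rw [Nat.cofinite_eq_atTop]
  simp only [psiCoeff_smul_matC_pow]
  exact tendsto_coe_of_mem_filtration fun k =>
    dEval_mem_filtration 𝕜 (isHomogeneous_psiTerm C k μ ν)

theorem tendsto_coe_dEval_psiTrunc (C : Fin n → Fin n → Fin n → 𝕜) (μ ν : Fin n) :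
    Tendsto (fun N => (dEval 𝕜 m (psiTrunc C N μ ν) : WeylSuperHat 𝕜 n m)) atTop
      (𝓝 (psiC m C μ ν)) := by
  have h := (summable_psiCoeff_smul_matC_pow (m := m) C μ ν).hasSum.tendsto_sum_nat.comp
    (tendsto_add_atTop_nat 1)
  refine h.congr fun N => ?_
  simp only [Function.comp_apply, psiCoeff_smul_matC_pow, psiTrunc, map_sum]
  exact (map_sum (Completion.coeRingHom (α := WeylSuper 𝕜 n m)) _ _).symm

end Completion

/-! ### Lie superalgebras with a homogeneous basis, and the realization -/

section Realization

open WeylSuper Filter Topology UniformSpace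

theorem WeylSuperHat.coe_mem_part {𝕜 : Type*} [Field 𝕜] {n m : ℕ} {i : ZMod 2}
    {a : WeylSuper 𝕜 n m} (ha : a ∈ WeylSuper.part 𝕜 n m i) :
    (a : WeylSuperHat 𝕜 n m) ∈ WeylSuperHat.part 𝕜 n m i :=
  Submodule.le_topologicalClosure _ (Submodule.subset_span ⟨a, ha, rfl⟩)

namespace LieSuperalgebra

variable {𝕜 : Type*} {g : Type*} [Field 𝕜] [AddCommGroup g] [Module 𝕜 g]
  (L : LieSuperalgebra 𝕜 g)

theorem disjoint_part : Disjoint (L.part 0) (L.part 1) :=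
  L.isInternal.submodule_iSupIndep.pairwiseDisjoint zero_ne_one

section Basis

variable {κ κ' : Type*} (Z : Module.Basis (κ ⊕ κ') 𝕜 g)
  (hX : ∀ μ, Z (Sum.inl μ) ∈ L.part 0) (hθ : ∀ a, Z (Sum.inr a) ∈ L.part 1)
include hX hθ

theorem mem_span_of_mem_part_zero [Fintype κ] [Fintype κ'] {x : g} (hx : x ∈ L.part 0) :
    x ∈ Submodule.span 𝕜 (Set.range fun μ => Z (Sum.inl μ)) := by
  have h := Z.sum_repr x
  rw [Fintype.sum_sum_type] at h
  have h0 : ∑ μ, Z.repr x (Sum.inl μ) • Z (Sum.inl μ) ∈ L.part 0 :=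
    sum_mem fun μ _ => Submodule.smul_mem _ _ (hX μ)
  have h1 : ∑ a, Z.repr x (Sum.inr a) • Z (Sum.inr a) ∈ L.part 1 :=
    sum_mem fun a _ => Submodule.smul_mem _ _ (hθ a)
  have h2 : ∑ a, Z.repr x (Sum.inr a) • Z (Sum.inr a) = 0 := by
    refine Submodule.disjoint_def.1 L.disjoint_part _ ?_ h1
    rw [← eq_sub_iff_add_eq'] at h
    rw [h]
    exact sub_mem hx h0
  rw [← h, h2, add_zero]
  exact sum_mem fun μ _ => Submodule.smul_mem _ _ (Submodule.subset_span ⟨μ, rfl⟩)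

theorem mem_span_of_mem_part_one [Fintype κ] [Fintype κ'] {x : g} (hx : x ∈ L.part 1) :
    x ∈ Submodule.span 𝕜 (Set.range fun a => Z (Sum.inr a)) := by
  have h := Z.sum_repr x
  rw [Fintype.sum_sum_type] at h
  have h0 : ∑ μ, Z.repr x (Sum.inl μ) • Z (Sum.inl μ) ∈ L.part 0 :=
    sum_mem fun μ _ => Submodule.smul_mem _ _ (hX μ)
  have h1 : ∑ a, Z.repr x (Sum.inr a) • Z (Sum.inr a) ∈ L.part 1 :=
    sum_mem fun a _ => Submodule.smul_mem _ _ (hθ a)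
  have h2 : ∑ μ, Z.repr x (Sum.inl μ) • Z (Sum.inl μ) = 0 := by
    refine Submodule.disjoint_def.1 L.disjoint_part _ h0 ?_
    rw [← eq_sub_iff_add_eq] at h
    rw [h]
    exact sub_mem hx h1
  rw [← h, h2, zero_add]
  exact sum_mem fun a _ => Submodule.smul_mem _ _ (Submodule.subset_span ⟨a, rfl⟩)

theorem bracket_even_odd (μ : κ) (a : κ') :
    L.bracket (Z (Sum.inl μ)) (Z (Sum.inr a)) = -L.bracket (Z (Sum.inr a)) (Z (Sum.inl μ)) := by
  simpa using L.skew 0 1 _ _ (hX μ) (hθ a)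

end Basis

theorem map_bracket_of_mem_span {A : Type*} [Ring A] [Algebra 𝕜 A] (φ : g →ₗ[𝕜] A) (i j : ZMod 2)
    (s t : Set g) (h : ∀ x ∈ s, ∀ y ∈ t, φ (L.bracket x y) = superComm 𝕜 i j (φ x) (φ y)) {x y : g}
    (hx : x ∈ Submodule.span 𝕜 s) (hy : y ∈ Submodule.span 𝕜 t) :
    φ (L.bracket x y) = superComm 𝕜 i j (φ x) (φ y) := by
  induction hx, hy using Submodule.span_induction₂ with
  | mem_mem x y hx hy => exact h x hx y hy
  | zero_left y hy => simp [superComm]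
  | zero_right x hx => simp [superComm]
  | add_left x y z hx hy hz h1 h2 =>
    simp only [map_add, LinearMap.add_apply, h1, h2, superComm, add_mul, mul_add, smul_add]
    abel
  | add_right x y z hx hy hz h1 h2 =>
    simp only [map_add, h1, h2, superComm, add_mul, mul_add, smul_add]
    abel
  | smul_left r x y hx hy h1 =>
    simp only [map_smul, LinearMap.smul_apply, h1, superComm, smul_mul_assoc, mul_smul_comm,
      smul_sub, smul_comm r]
  | smul_right r x y hx hy h1 =>
    simp only [map_smul, h1, superComm, smul_mul_assoc, mul_smul_comm, smul_sub, smul_comm r]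

section StructureConstants

variable {κ κ' : Type*} [Fintype κ] (Z : Module.Basis (κ ⊕ κ') 𝕜 g)
  (hX : ∀ μ, Z (Sum.inl μ) ∈ L.part 0) (C : κ → κ → κ → 𝕜)
  (hXX : ∀ μ ν, L.bracket (Z (Sum.inl μ)) (Z (Sum.inl ν)) = ∑ α, C μ ν α • Z (Sum.inl α))
include hX hXX

theorem structureConstants_skew (μ ν α : κ) : C μ ν α = -C ν μ α := by
  have h : L.bracket (Z (Sum.inl μ)) (Z (Sum.inl ν))
      = -L.bracket (Z (Sum.inl ν)) (Z (Sum.inl μ)) := by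
    simpa using L.skew 0 0 _ _ (hX μ) (hX ν)
  classical
  rw [hXX, hXX] at h
  have h' := congrArg (fun x => Z.repr x (Sum.inl α)) h
  simpa [Finsupp.single_apply] using h'

theorem structureConstants_jacobi (μ ν τ α : κ) :
    ∑ ρ, (C μ τ ρ * C ρ ν α + C ν τ ρ * C μ ρ α - C μ ν ρ * C ρ τ α) = 0 := by
  classical
  have hskew := L.structureConstants_skew Z hX C hXX
  have h : L.bracket (Z (Sum.inl μ)) (L.bracket (Z (Sum.inl ν)) (Z (Sum.inl τ)))
      + L.bracket (Z (Sum.inl ν)) (L.bracket (Z (Sum.inl τ)) (Z (Sum.inl μ)))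
      + L.bracket (Z (Sum.inl τ)) (L.bracket (Z (Sum.inl μ)) (Z (Sum.inl ν))) = 0 := by
    simpa using L.jacobi 0 0 0 _ _ _ (hX μ) (hX ν) (hX τ)
  have h' := congrArg (fun x => Z.repr x (Sum.inl α)) h
  simp [hXX, Finsupp.single_apply] at h'
  rw [← h', ← sum_add_distrib, ← sum_add_distrib]
  refine sum_congr rfl fun ρ _ => ?_
  rw [hskew μ τ ρ, hskew ρ ν α, hskew ρ τ α]
  ring

/-- The Jacobi identity for one odd and two even elements: the even elements act on the odd part
by the matrices `-K_μ`, with `(K_μ)_ab = K_bμa`. -/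
theorem structureConstants_commutator [Fintype κ'] (hθ : ∀ a, Z (Sum.inr a) ∈ L.part 1)
    (K : κ' → κ → κ' → 𝕜)
    (hθX : ∀ a ν, L.bracket (Z (Sum.inr a)) (Z (Sum.inl ν)) = ∑ b, K a ν b • Z (Sum.inr b))
    (μ ν : κ) :
    Matrix.of (fun a b => K b μ a) * Matrix.of (fun a b => K b ν a)
        - Matrix.of (fun a b => K b ν a) * Matrix.of (fun a b => K b μ a)
      = -∑ α, C μ ν α • Matrix.of fun a b => K b α a := by
  classical
  ext a d
  have h : L.bracket (Z (Sum.inr d)) (L.bracket (Z (Sum.inl μ)) (Z (Sum.inl ν)))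
      + L.bracket (Z (Sum.inl μ)) (L.bracket (Z (Sum.inl ν)) (Z (Sum.inr d)))
      + L.bracket (Z (Sum.inl ν)) (L.bracket (Z (Sum.inr d)) (Z (Sum.inl μ))) = 0 := by
    simpa using L.jacobi 1 0 0 _ _ _ (hθ d) (hX μ) (hX ν)
  have h' := congrArg (fun x => Z.repr x (Sum.inr a)) h
  simp [hXX, hθX, L.bracket_even_odd Z hX hθ, Finsupp.single_apply] at h'
  simp only [Matrix.sub_apply, Matrix.neg_apply, Matrix.mul_apply, Matrix.of_apply,
    Matrix.sum_apply, Matrix.smul_apply, smul_eq_mul, mul_comm (K _ μ a), mul_comm (K _ ν a)]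
  linear_combination h'

end StructureConstants

end LieSuperalgebra

variable {𝕜 : Type*} {g : Type*} [Field 𝕜] [AddCommGroup g] [Module 𝕜 g] {n m : ℕ}
  (Z : Module.Basis (Fin n ⊕ Fin m) 𝕜 g) (C : Fin n → Fin n → Fin n → 𝕜)
  (K : Fin m → Fin n → Fin m → 𝕜)

theorem weylLinear_odd (a : Fin m) :
    weylLinear Z C K (Z (Sum.inr a)) = (gen 𝕜 (.xi a) : WeylSuper 𝕜 n m) := by
  rw [weylLinear, Module.Basis.constr_basis]
  rfl

theorem tendsto_truncImage (μ : Fin n) :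
    Tendsto (fun N => (truncImage m C (fun μ => Matrix.of fun a b => K b μ a) N μ :
      WeylSuperHat 𝕜 n m)) atTop (𝓝 (weylLinear Z C K (Z (Sum.inl μ)))) := by
  rw [weylLinear, Module.Basis.constr_basis, Sum.elim_inl]
  have hf : ((fermi 𝕜 n (Matrix.of fun a b => K b μ a) : WeylSuper 𝕜 n m) : WeylSuperHat 𝕜 n m)
      = ∑ a, ∑ b, K b μ a • (WeylSuperHat.gen 𝕜 (.xi a) * WeylSuperHat.gen 𝕜 (.q b)) := by
    change Completion.coeRingHom _ = _
    rw [fermi_apply, map_sum]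
    refine sum_congr rfl fun a _ => ?_
    rw [map_sum]
    refine sum_congr rfl fun b _ => ?_
    exact (Completion.coe_smul _ _).trans (congrArg _ (Completion.coe_mul _ _))
  rw [← hf]
  have h := (tendsto_finsetSum univ fun α _ =>
    (tendsto_coe_dEval_psiTrunc (m := m) C μ α).const_mul
      (WeylSuperHat.gen 𝕜 (.x α))).sub_const
        ((fermi 𝕜 n (Matrix.of fun a b => K b μ a) : WeylSuper 𝕜 n m) : WeylSuperHat 𝕜 n m)
  refine h.congr fun N => ?_
  change _ = Completion.coeRingHom _
  rw [truncImage, map_sub, xLinear, map_sum]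
  simp only [map_mul]
  rfl

theorem weylLinear_bracket_even_even [CharZero 𝕜] (L : LieSuperalgebra 𝕜 g)
    (hX : ∀ μ, Z (Sum.inl μ) ∈ L.part 0) (hθ : ∀ a, Z (Sum.inr a) ∈ L.part 1)
    (hXX : ∀ μ ν, L.bracket (Z (Sum.inl μ)) (Z (Sum.inl ν)) = ∑ α, C μ ν α • Z (Sum.inl α))
    (hθX : ∀ a ν, L.bracket (Z (Sum.inr a)) (Z (Sum.inl ν)) = ∑ b, K a ν b • Z (Sum.inr b))
    (μ ν : Fin n) :
    weylLinear Z C K (L.bracket (Z (Sum.inl μ)) (Z (Sum.inl ν)))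
      = weylLinear Z C K (Z (Sum.inl μ)) * weylLinear Z C K (Z (Sum.inl ν))
        - weylLinear Z C K (Z (Sum.inl ν)) * weylLinear Z C K (Z (Sum.inl μ)) := by
  have hlim := tendsto_truncImage Z C K
  have h1 := tendsto_coe_of_mem_filtration fun N => truncImage_commutator_mem_filtration C
    (fun μ => Matrix.of fun a b => K b μ a) (L.structureConstants_skew Z hX C hXX)
    (L.structureConstants_jacobi Z hX C hXX)
    (L.structureConstants_commutator Z hX C hXX hθ K hθX) N μ ν
  have h2 := (((hlim μ).mul (hlim ν)).sub ((hlim ν).mul (hlim μ))).sub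
    (tendsto_finsetSum univ fun α _ => (hlim α).const_smul (C μ ν α))
  have h3 := tendsto_nhds_unique (h2.congr fun N => ?_) h1
  · rw [hXX, map_sum, eq_comm, ← sub_eq_zero]
    simpa only [map_smul] using h3
  · rw [Completion.coe_sub, Completion.coe_sub, Completion.coe_mul, Completion.coe_mul]
    congr 1
    refine Eq.trans ?_ (map_sum (Completion.coeRingHom (α := WeylSuper 𝕜 n m)) _ _).symm
    exact sum_congr rfl fun α _ => (Completion.coe_smul _ _).symm

theorem weylLinear_bracket_odd_even (L : LieSuperalgebra 𝕜 g)
    (hθX : ∀ a ν, L.bracket (Z (Sum.inr a)) (Z (Sum.inl ν)) = ∑ b, K a ν b • Z (Sum.inr b))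
    (a : Fin m) (μ : Fin n) :
    weylLinear Z C K (L.bracket (Z (Sum.inr a)) (Z (Sum.inl μ)))
      = weylLinear Z C K (Z (Sum.inr a)) * weylLinear Z C K (Z (Sum.inl μ))
        - weylLinear Z C K (Z (Sum.inl μ)) * weylLinear Z C K (Z (Sum.inr a)) := by
  have hlim := tendsto_truncImage Z C K μ
  have h2 := (hlim.const_mul (weylLinear Z C K (Z (Sum.inr a)))).sub
    (hlim.mul_const (weylLinear Z C K (Z (Sum.inr a))))
  refine tendsto_nhds_unique (tendsto_const_nhds.congr fun N => ?_) h2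
  rw [weylLinear_odd, ← Completion.coe_mul, ← Completion.coe_mul, ← Completion.coe_sub,
    truncImage_mul_xi, hθX, map_sum]
  refine Eq.trans ?_ (map_sum (Completion.coeRingHom (α := WeylSuper 𝕜 n m)) _ _).symm
  refine sum_congr rfl fun b _ => ?_
  rw [map_smul, weylLinear_odd]
  exact (Completion.coe_smul _ _).symm

theorem weylLinear_odd_anticommute (a b : Fin m) :
    weylLinear Z C K (Z (Sum.inr a)) * weylLinear Z C K (Z (Sum.inr b))
      + weylLinear Z C K (Z (Sum.inr b)) * weylLinear Z C K (Z (Sum.inr a)) = 0 := by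
  rw [weylLinear_odd, weylLinear_odd, ← Completion.coe_mul, gen_xi_mul_xi, Completion.coe_neg,
    Completion.coe_mul, neg_add_cancel]

theorem weylLinear_even_mem_part (μ : Fin n) :
    weylLinear Z C K (Z (Sum.inl μ)) ∈ WeylSuperHat.part 𝕜 n m 0 :=
  (Submodule.isClosed_topologicalClosure _).mem_of_tendsto (tendsto_truncImage Z C K μ)
    (Eventually.of_forall fun N => WeylSuperHat.coe_mem_part (truncImage_mem_part C _ N μ))

theorem weylLinear_odd_mem_part (a : Fin m) :
    weylLinear Z C K (Z (Sum.inr a)) ∈ WeylSuperHat.part 𝕜 n m 1 := by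
  rw [weylLinear_odd]
  exact WeylSuperHat.coe_mem_part (gen_mem_part 𝕜 (.xi a))

end Realization

end

theorem proposition2 {𝕜 : Type*} [RCLike 𝕜] {g : Type*} [AddCommGroup g] [Module 𝕜 g]
    (L : LieSuperalgebra 𝕜 g) {n m : ℕ} (Z : Module.Basis (Fin n ⊕ Fin m) 𝕜 g)
    (hX : ∀ μ, Z (Sum.inl μ) ∈ L.part 0) (hθ : ∀ a, Z (Sum.inr a) ∈ L.part 1)
    (C : Fin n → Fin n → Fin n → 𝕜) (K : Fin m → Fin n → Fin m → 𝕜)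
    (hXX : ∀ μ ν, L.bracket (Z (Sum.inl μ)) (Z (Sum.inl ν)) = ∑ α, C μ ν α • Z (Sum.inl α))
    (hθX : ∀ a ν, L.bracket (Z (Sum.inr a)) (Z (Sum.inl ν)) = ∑ b, K a ν b • Z (Sum.inr b))
    (hθθ : ∀ a b, L.bracket (Z (Sum.inr a)) (Z (Sum.inr b)) = 0) :
    (∀ μ α, Summable fun k : ℕ => psiCoeff 𝕜 k • (matC m C ^ k) μ α) ∧
      L.IsRealization (weylLinear Z C K) := by
  have hzmod : ∀ i : ZMod 2, i = 0 ∨ i = 1 := by decide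
  refine ⟨summable_psiCoeff_smul_matC_pow C, fun i x hx => ?_, fun i j x y hx hy => ?_⟩
  · rcases hzmod i with rfl | rfl
    · refine (Submodule.span_le (p := (WeylSuperHat.part 𝕜 n m 0).comap (weylLinear Z C K))).2 ?_
        (L.mem_span_of_mem_part_zero Z hX hθ hx)
      rintro _ ⟨μ, rfl⟩
      exact weylLinear_even_mem_part Z C K μ
    · refine (Submodule.span_le (p := (WeylSuperHat.part 𝕜 n m 1).comap (weylLinear Z C K))).2 ?_
        (L.mem_span_of_mem_part_one Z hX hθ hx)
      rintro _ ⟨a, rfl⟩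
      exact weylLinear_odd_mem_part Z C K a
  · rcases hzmod i with rfl | rfl <;> rcases hzmod j with rfl | rfl
    · refine L.map_bracket_of_mem_span _ 0 0 _ _ ?_ (L.mem_span_of_mem_part_zero Z hX hθ hx)
        (L.mem_span_of_mem_part_zero Z hX hθ hy)
      rintro _ ⟨μ, rfl⟩ _ ⟨ν, rfl⟩
      simpa [superComm] using weylLinear_bracket_even_even Z C K L hX hθ hXX hθX μ ν
    · refine L.map_bracket_of_mem_span _ 0 1 _ _ ?_ (L.mem_span_of_mem_part_zero Z hX hθ hx)
        (L.mem_span_of_mem_part_one Z hX hθ hy)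
      rintro _ ⟨μ, rfl⟩ _ ⟨a, rfl⟩
      rw [L.bracket_even_odd Z hX hθ, map_neg, weylLinear_bracket_odd_even Z C K L hθX]
      simp [superComm]
    · refine L.map_bracket_of_mem_span _ 1 0 _ _ ?_ (L.mem_span_of_mem_part_one Z hX hθ hx)
        (L.mem_span_of_mem_part_zero Z hX hθ hy)
      rintro _ ⟨a, rfl⟩ _ ⟨μ, rfl⟩
      simpa [superComm] using weylLinear_bracket_odd_even Z C K L hθX a μ
    · refine L.map_bracket_of_mem_span _ 1 1 _ _ ?_ (L.mem_span_of_mem_part_one Z hX hθ hx)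
        (L.mem_span_of_mem_part_one Z hX hθ hy)
      rintro _ ⟨a, rfl⟩ _ ⟨b, rfl⟩
      simp only [hθθ, map_zero, superComm, ZMod.val_one, mul_one, pow_one, neg_smul, one_smul,
        sub_neg_eq_add]
      exact (weylLinear_odd_anticommute Z C K a b).symm
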